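/- Let $\kappa$ be a field of characteristic $0$ (for instance $\overline{\mathbb{Q}}_\ell$). For a partition $\lambda$ let $s_\lambda(\mathbf{x})$ be the Schur function in infinitely many variables $\mathbf{x}=\{x_1,x_2,\dots\}$, let $\chi^\lambda=\det(\eta_{\lambda_i-i+j})_{i,j}$ be the irreducible character of $S_{|\lambda|}$ attached to $\lambda$ (where $\eta_k$ is the trivial character of $S_k$, zero for $k<0$, and the product of characters is induction from Young subgroups), and let $V_\lambda$ be an irreducible $\kappa[S_{|\lambda|}]$-module with character $\chi^\lambda$. Let $\omega=(d_1,\omega^1)\cdots(d_r,\omega^r)$ be a finite sequence of pairs of an integer $d_i\ge 1$ and a nonempty partition $\omega^i$, put $n=\sum_i d_i|\omega^i|$ and let $\omega^+=\sum_i d_i\cdot\omega^i$ be the partition of $n$ with parts $\omega^+_k=\sum_i d_i\,\omega^i_k$. There is a unique family of integers $(c_\omega^\mu)_{\mu}$, indexed by the partitions $\mu$ of $n$, with $c_\omega^\mu=0$ unless $\mu\unlhd\omega^+$ in the dominance order, such that $$s_{\omega^1}(\mathbf{x}^{d_1})\cdots s_{\omega^r}(\mathbf{x}^{d_r})=\sum_{\mu\unlhd\omega^+}c_\omega^\mu\,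 s_\mu(\mathbf{x}),\qquad \mathbf{x}^d:=\{x_1^d,x_2^d,\dots\}$$ (the twisted Littlewood–Richardson coefficients). Put $S:=\prod_i (S_{|\omega^i|})^{d_i}\subset S_n$ and $V_\omega:=\bigotimes_{i=1}^r V_{\omega^i}^{\otimes d_i}$, and let $\rho:S\to \mathrm{GL}(V_\omega)$ be the corresponding representation. Let $N_{S_n}(S,\rho)$ be the group of those $t$ in the normalizer of $S$ in $S_n$ for which the representation $s\mapsto\rho(t^{-1}st)$ is isomorphic to $\rho$, and $W_{S_n}(S,\rho):=N_{S_n}(S,\rho)/S$. The group $\prod_i\big((S_{|\omega^i|})^{d_i}\rtimes S_{d_i}\big)\subset N_{S_n}(S,\rho)$, where $S_{d_i}$ permutes the coordinates, acts on $V_\omega$, its action on the factor $V_{\omega^i}^{\otimes d_i}$ being $(w,s)\cdot(x_1\otimes\cdots\otimes x_{d_i})=w_1x_{s^{-1}(1)}\otimes\cdots\otimes w_{d_i}x_{s^{-1}(d_i)}$. An element $t$ of it acts on $\mathrm{Ind}_S^{S_n}(V_\omega)=\kappa[S_n]\otimes_{\kappa[S]}V_\omega$ by $t\cdot(x\otimes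 u)=xt^{-1}\otimes t\cdot u$, and on $\mathrm{Hom}_{S_n}(\mathrm{Ind}_S^{S_n}(V_\omega),V_\mu)$ by $(t\cdot f)(z)=f(t^{-1}\cdot z)$; the latter action depends only on the class of $t$ in $W_{S_n}(S,\rho)$. Let $v\in W_{S_n}(S,\rho)$ be the element which acts on each $(S_{|\omega^i|})^{d_i}$ by circular permutation of the coordinates, $(g_1,\dots,g_{d_i})\mapsto(g_2,\dots,g_{d_i},g_1)$. Then for every partition $\mu$ of $n$, $$\mathrm{Tr}\left(v\,\middle|\,\mathrm{Hom}_{S_n}\big(\mathrm{Ind}_S^{S_n}(V_\omega),V_\mu\big)\right)=c_\omega^\mu.$$ -/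

import Mathlib

open scoped TensorProduct

noncomputable section

namespace TwistedLR

/-! ### Schur functions and irreducible characters of symmetric groups -/

/-- The Schur function `s_lam` in the infinitely many variables `x_0, x_1, x_2, …`: the coefficient
of the monomial `x^m` is the number of semistandard Young tableaux of shape `lam` and weight `m`. -/
def schur (lam : YoungDiagram) : MvPowerSeries ℕ ℤ := fun m =>
  (Nat.card {T : SemistandardYoungTableau lam //
    ∀ k : ℕ, (lam.cells.filter fun c => T c.1 c.2 = k).card = m k} : ℤ)

/-- The value at `g` of the permutation character `η_{a_0} η_{a_1} ⋯ η_{a_{l-1}}`, that is, of the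
character of the symmetric group induced from the trivial character of the Young subgroup
`S_{a_0} × ⋯ × S_{a_{l-1}}`: the number of maps `f` to `{0, …, l-1}` which are fixed by `g` and whose
fibre over `j` has `a_j` elements. It vanishes if some `a_j` is negative. -/
def youngPermChar {X : Type*} [Fintype X] {l : ℕ} (a : Fin l → ℤ) (g : Equiv.Perm X) : ℤ :=
  (Nat.card {f : X → Fin l // (∀ x, f (g x) = f x) ∧
    ∀ j, (Nat.card {x : X // f x = j} : ℤ) = a j} : ℤ)

/-- The character `χ^lam = det (η_{lam_i - i + j})` of the symmetric group, where `η_k` is the trivial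
character of `S_k` (zero for `k < 0`) and characters are multiplied by inducing them from
Young subgroups. Here `lam.rowLen i` is the part `lam_{i+1}` and `lam.colLen 0` is the length. -/
def chi (lam : YoungDiagram) {X : Type*} [Fintype X] (g : Equiv.Perm X) : ℤ :=
  ∑ s : Equiv.Perm (Fin (lam.colLen 0)), (Equiv.Perm.sign s : ℤ) *
    youngPermChar (fun i => (lam.rowLen (i : ℕ) : ℤ) - ((i : ℕ) : ℤ) + ((s i : ℕ) : ℤ)) g

/-! ### Types and twisted Littlewood–Richardson coefficients -/

/-- A type `ω = (d_1, ω^1) ⋯ (d_r, ω^r)`: a sequence of pairs of a positive integer and a nonempty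
partition. -/
structure PType where
  r : ℕ
  deg : Fin r → ℕ
  part : Fin r → YoungDiagram
  deg_ne : ∀ i, deg i ≠ 0
  part_ne : ∀ i, part i ≠ ⊥

namespace PType

variable (ω : PType)

/-- The product `s_ω(x) = s_{ω^1}(x^{d_1}) ⋯ s_{ω^r}(x^{d_r})`. -/
def schurProd : MvPowerSeries ℕ ℤ :=
  ∏ i, MvPowerSeries.expand (ω.deg i) (ω.deg_ne i) (schur (ω.part i))

/-- The size `∑ d_i |ω^i|`. -/
def size : ℕ := ∑ i, ω.deg i * (ω.part i).card

/-- `μ ⊴ ω⁺` in the dominance order, where `ω⁺ = ∑ d_i · ω^i` is the partition with parts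
`ω⁺_k = ∑ d_i ω^i_k`; this includes `|μ| = |ω⁺| = ∑ d_i |ω^i|`. -/
def DominatedByPlus (mu : YoungDiagram) : Prop :=
  mu.card = ω.size ∧ ∀ k : ℕ, ∑ j ∈ Finset.range k, mu.rowLen j ≤
    ∑ j ∈ Finset.range k, ∑ i, ω.deg i * (ω.part i).rowLen j

/-- `c` is the family of twisted Littlewood–Richardson coefficients of `ω`:
`s_ω(x) = ∑_{μ ⊴ ω⁺} c_ω^μ s_μ(x)`, and `c_ω^μ = 0` for the other partitions `μ`. -/
def IsTwistedLR (c : YoungDiagram →₀ ℤ) : Prop :=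
  (∀ mu, c mu ≠ 0 → ω.DominatedByPlus mu) ∧
    ω.schurProd = c.sum fun mu a => a • schur mu

/-! ### The group `S`, its normalizer, and the representation `V_ω` -/

/-- The blocks: `d_i` copies for each `i`. -/
abbrev Block := Σ i : Fin ω.r, Fin (ω.deg i)

/-- The points permuted by `S`: each of the `d_i` blocks with index `i` has `|ω^i|` points. -/
abbrev Point := Σ b : ω.Block, Fin (ω.part b.1).card

/-- The abstract product `∏ (S_{|ω^i|})^{d_i}`. -/
abbrev Base := (b : ω.Block) → Equiv.Perm (Fin (ω.part b.1).card)

/-- The group `∏ S_{d_i}` permuting the blocks with the same index. -/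
abbrev Top := (i : Fin ω.r) → Equiv.Perm (Fin (ω.deg i))

variable {ω}

/-- The action of `∏ S_{d_i}` on the blocks. -/
def blockPerm (p : ω.Top) : Equiv.Perm ω.Block where
  toFun b := ⟨b.1, p b.1 b.2⟩
  invFun b := ⟨b.1, (p b.1).symm b.2⟩
  left_inv b := by simp
  right_inv b := by simp

variable (ω)

theorem point_congr {i : Fin ω.r} {k k' : Fin (ω.deg i)} (h : k = k')
    (y : Fin (ω.part i).card) : (⟨⟨i, k⟩, y⟩ : ω.Point) = ⟨⟨i, k'⟩, y⟩ := by
  subst h; rfl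

theorem base_congr (w : ω.Base) {i : Fin ω.r} {k k' : Fin (ω.deg i)} (h : k = k') :
    (w ⟨i, k⟩ : Equiv.Perm (Fin (ω.part i).card)) = w ⟨i, k'⟩ := by
  subst h; rfl

/-- The action of `∏ S_{d_i}` on the points. -/
def topPointHom : ω.Top →* Equiv.Perm ω.Point where
  toFun p :=
    { toFun := fun x => ⟨⟨x.1.1, p x.1.1 x.1.2⟩, x.2⟩
      invFun := fun x => ⟨⟨x.1.1, (p x.1.1).symm x.1.2⟩, x.2⟩
      left_inv := fun ⟨⟨i, k⟩, y⟩ => point_congr ω ((p i).symm_apply_apply k) y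
      right_inv := fun ⟨⟨i, k⟩, y⟩ => point_congr ω ((p i).apply_symm_apply k) y }
  map_one' := rfl
  map_mul' _ _ := rfl

/-- `∏ S_{d_i}` acts on `∏ (S_{|ω^i|})^{d_i}` by permutation of the coordinates. -/
def topAut : ω.Top →* MulAut ω.Base where
  toFun p :=
    { toFun := fun w b => w ⟨b.1, (p b.1).symm b.2⟩
      invFun := fun w b => w ⟨b.1, p b.1 b.2⟩
      left_inv := fun w => by
        funext ⟨i, k⟩
        exact base_congr ω w ((p i).symm_apply_apply k)
      right_inv := fun w => by
        funext ⟨i, k⟩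
        exact base_congr ω w ((p i).apply_symm_apply k)
      map_mul' := fun _ _ => rfl }
  map_one' := rfl
  map_mul' _ _ := rfl

/-- The semidirect product `∏ ((S_{|ω^i|})^{d_i} ⋊ S_{d_i})`. -/
abbrev Ext := ω.Base ⋊[ω.topAut] ω.Top

theorem base_top_points (p : ω.Top) :
    (Equiv.Perm.sigmaCongrRightHom fun b : ω.Block => Fin (ω.part b.1).card).comp
        (ω.topAut p).toMonoidHom =
      (MulAut.conj (ω.topPointHom p)).toMonoidHom.comp
        (Equiv.Perm.sigmaCongrRightHom fun b : ω.Block => Fin (ω.part b.1).card) := by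
  ext1 w
  refine Equiv.ext fun x => ?_
  obtain ⟨⟨i, k⟩, y⟩ := x
  change (⟨⟨i, k⟩, w ⟨i, (p i).symm k⟩ y⟩ : ω.Point) =
    ⟨⟨i, p i ((p i).symm k)⟩, w ⟨i, (p i).symm k⟩ y⟩
  exact ω.point_congr ((p i).apply_symm_apply k).symm _

section Embedded

variable {n : ℕ} (e : ω.Point ≃ Fin n)

/-- The embedding of `∏ (S_{|ω^i|})^{d_i}` into `S_n`, the points being numbered by `e`. -/
def baseHom : ω.Base →* Equiv.Perm (Fin n) :=
  e.permCongrHom.toMonoidHom.comp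
    (Equiv.Perm.sigmaCongrRightHom fun b : ω.Block => Fin (ω.part b.1).card)

theorem baseHom_injective : Function.Injective (ω.baseHom e) :=
  e.permCongrHom.injective.comp Equiv.Perm.sigmaCongrRightHom_injective

/-- The map `∏ ((S_{|ω^i|})^{d_i} ⋊ S_{d_i}) → S_n`. -/
def extHom : ω.Ext →* Equiv.Perm (Fin n) :=
  SemidirectProduct.lift (ω.baseHom e) (e.permCongrHom.toMonoidHom.comp ω.topPointHom) fun p => by
    ext1 w
    have h := congrArg e.permCongrHom (DFunLike.congr_fun (ω.base_top_points p) w)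
    simpa only [baseHom, MulAut.conj_apply, MonoidHom.comp_apply, MulEquiv.coe_toMonoidHom,
      map_mul, map_inv] using h

/-- The subgroup `S` of `S_n`. -/
def subgroupS : Subgroup (Equiv.Perm (Fin n)) := (ω.baseHom e).range

/-- `S` as the product `∏ (S_{|ω^i|})^{d_i}`. -/
def baseEquiv : ω.Base ≃* ω.subgroupS e :=
  MonoidHom.ofInjective (ω.baseHom_injective e)

end Embedded

section Rep

variable {κ : Type*} [Field κ] {V : YoungDiagram → Type*} [∀ lam, AddCommGroup (V lam)]
  [∀ lam, Module κ (V lam)]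
  (ρ : ∀ lam : YoungDiagram, Representation κ (Equiv.Perm (Fin lam.card)) (V lam))

/-- The space `V_ω = ⨂ T^{d_i} V_{ω^i}`. -/
abbrev VSpace (κ : Type*) [Field κ] (V : YoungDiagram → Type*) [∀ lam, AddCommGroup (V lam)]
    [∀ lam, Module κ (V lam)] : Type _ :=
  ⨂[κ] b : ω.Block, V (ω.part b.1)

/-- The outer tensor product representation of `∏ (S_{|ω^i|})^{d_i}` on `V_ω`. -/
def baseRep : Representation κ ω.Base (ω.VSpace κ V) :=
  PiTensorProduct.mapMonoidHom.comp
    (MonoidHom.pi fun b : ω.Block => (ρ (ω.part b.1)).comp (Pi.evalMonoidHom _ b))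

variable (κ V) in
/-- `∏ S_{d_i}` acts on `V_ω` by permuting the tensor factors. -/
def topOp (p : ω.Top) : ω.VSpace κ V →ₗ[κ] ω.VSpace κ V :=
  (PiTensorProduct.reindex κ (fun b : ω.Block => V (ω.part b.1)) (blockPerm p)).toLinearMap

theorem topOp_tprod (p : ω.Top) (x : ∀ b : ω.Block, V (ω.part b.1)) :
    ω.topOp κ V p (PiTensorProduct.tprod κ x) =
      PiTensorProduct.tprod κ fun b : ω.Block => x ⟨b.1, (p b.1).symm b.2⟩ :=
  PiTensorProduct.reindex_tprod (blockPerm p) x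

theorem baseRep_tprod (w : ω.Base) (x : ∀ b : ω.Block, V (ω.part b.1)) :
    ω.baseRep ρ w (PiTensorProduct.tprod κ x) =
      PiTensorProduct.tprod κ fun b => ρ (ω.part b.1) (w b) (x b) :=
  PiTensorProduct.map_tprod _ x

variable (κ V) in
/-- `topOp` as a representation of `∏ S_{d_i}`. -/
def topRep : Representation κ ω.Top (ω.VSpace κ V) where
  toFun := ω.topOp κ V
  map_one' := by
    refine PiTensorProduct.ext (MultilinearMap.ext fun x => ?_)
    exact ω.topOp_tprod 1 x
  map_mul' p q := by
    refine PiTensorProduct.ext (MultilinearMap.ext fun x => ?_)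
    change ω.topOp κ V (p * q) (PiTensorProduct.tprod κ x) =
      ω.topOp κ V p (ω.topOp κ V q (PiTensorProduct.tprod κ x))
    rw [topOp_tprod, topOp_tprod, topOp_tprod]
    rfl

theorem topRep_baseRep (p : ω.Top) (w : ω.Base) :
    ω.topRep κ V p * ω.baseRep ρ w = ω.baseRep ρ (ω.topAut p w) * ω.topRep κ V p := by
  refine PiTensorProduct.ext (MultilinearMap.ext fun x => ?_)
  change ω.topOp κ V p (ω.baseRep ρ w (PiTensorProduct.tprod κ x)) =
    ω.baseRep ρ (ω.topAut p w) (ω.topOp κ V p (PiTensorProduct.tprod κ x))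
  rw [topOp_tprod, baseRep_tprod, topOp_tprod, baseRep_tprod]
  rfl

/-- The action of `∏ ((S_{|ω^i|})^{d_i} ⋊ S_{d_i})` on `V_ω`:
`(w, s) · ⨂ x_b = ⨂ w_b · x_{s⁻¹ b}`. -/
def extRep : Representation κ ω.Ext (ω.VSpace κ V) where
  toFun g := ω.baseRep ρ g.left * ω.topRep κ V g.right
  map_one' := by simp
  map_mul' g h := by
    simp only [SemidirectProduct.mul_left, SemidirectProduct.mul_right, map_mul]
    rw [mul_assoc, mul_assoc, ← mul_assoc (ω.topRep κ V g.right), topRep_baseRep]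
    simp only [mul_assoc]

variable {n : ℕ} (e : ω.Point ≃ Fin n)

/-- The representation `ρ : S → GL(V_ω)`. -/
def repS : Representation κ (ω.subgroupS e) (ω.VSpace κ V) :=
  (ω.baseRep ρ).comp (ω.baseEquiv e).symm.toMonoidHom

end Rep

end PType

/-! ### The groups `N_K(H, ρ)` and `W_K(H, ρ)` -/

section Stabilizer

variable {κ K A : Type*} [Field κ] [Group K] [AddCommGroup A] [Module κ A]
  (H : Subgroup K) (σ : Representation κ H A)

/-- For `t` in the normalizer of `H`, the representation `t^*(σ) = σ ∘ t⁻¹ : h ↦ σ (t⁻¹ h t)`. -/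
def twist (t : Subgroup.normalizer (H : Set K)) : Representation κ H A :=
  σ.comp (H.normalizerMonoidHom t)⁻¹.toMonoidHom

theorem twist_apply (t : Subgroup.normalizer (H : Set K)) (h : H) :
    twist H σ t h = σ ((H.normalizerMonoidHom t)⁻¹ h) := rfl

theorem twist_mul (s t : Subgroup.normalizer (H : Set K)) :
    twist H σ (s * t) = twist H (twist H σ t) s := by
  ext1 h
  simp only [twist_apply, map_mul, mul_inv_rev, MulAut.mul_apply]

theorem twist_one : twist H σ 1 = σ := by
  ext1 h
  simp only [twist_apply, map_one, inv_one, MulAut.one_apply]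

/-- An isomorphism stays an isomorphism after twisting. -/
def twistEquiv {σ τ : Representation κ H A} (f : σ.Equiv τ)
    (t : Subgroup.normalizer (H : Set K)) : (twist H σ t).Equiv (twist H τ t) :=
  Representation.Equiv.mk f.toLinearEquiv fun _ => f.isIntertwining' _

/-- `N_K(H, σ)`: the elements `t` of the normalizer of `H` in `K` with `t^*(σ) ≃ σ`. -/
def stabN : Subgroup (Subgroup.normalizer (H : Set K)) where
  carrier := {t | Nonempty ((twist H σ t).Equiv σ)}
  one_mem' := by
    rw [Set.mem_ofPred_eq, twist_one]
    exact ⟨Representation.Equiv.refl σ⟩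
  mul_mem' := by
    rintro s t ⟨f⟩ ⟨g⟩
    rw [Set.mem_ofPred_eq, twist_mul]
    exact ⟨(twistEquiv H g s).trans f⟩
  inv_mem' := by
    rintro s ⟨f⟩
    have h := twistEquiv H f s⁻¹
    rw [← twist_mul, inv_mul_cancel, twist_one] at h
    exact ⟨h.symm⟩

/-- `W_K(H, σ) = N_K(H, σ) / H`. -/
abbrev stabW : Type _ :=
  stabN H σ ⧸ (H.subgroupOf (Subgroup.normalizer (H : Set K))).subgroupOf (stabN H σ)

end Stabilizer

namespace PType

variable (ω : PType) {κ : Type*} [Field κ] {V : YoungDiagram → Type*}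
  [∀ lam, AddCommGroup (V lam)] [∀ lam, Module κ (V lam)]
  (ρ : ∀ lam : YoungDiagram, Representation κ (Equiv.Perm (Fin lam.card)) (V lam))
  {n : ℕ} (e : ω.Point ≃ Fin n)

/-- Conjugation by `g ∈ S ⋊ ∏ S_{d_i}` on the first factor. -/
def extConj (g : ω.Ext) : MulAut ω.Base := MulAut.conj g.left * ω.topAut g.right

theorem extHom_conj (g : ω.Ext) (w : ω.Base) :
    ω.extHom e g * ω.baseHom e w * (ω.extHom e g)⁻¹ = ω.baseHom e (ω.extConj g w) := by
  have h1 : ∀ u : ω.Base, ω.baseHom e u = ω.extHom e (SemidirectProduct.inl u) := fun u => by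
    simp [extHom]
  rw [h1, h1, ← map_inv, ← map_mul, ← map_mul]
  congr 1
  ext1 <;> simp [extConj, mul_assoc]

theorem extRep_baseRep (g : ω.Ext) (w : ω.Base) :
    ω.extRep ρ g * ω.baseRep ρ w = ω.baseRep ρ (ω.extConj g w) * ω.extRep ρ g := by
  change ω.baseRep ρ g.left * ω.topRep κ V g.right * ω.baseRep ρ w =
    ω.baseRep ρ (ω.extConj g w) * (ω.baseRep ρ g.left * ω.topRep κ V g.right)
  rw [mul_assoc, topRep_baseRep, ← mul_assoc, ← mul_assoc, ← map_mul, ← map_mul]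
  simp [extConj]

theorem extHom_mem_normalizer (g : ω.Ext) :
    ω.extHom e g ∈ Subgroup.normalizer (ω.subgroupS e : Set (Equiv.Perm (Fin n))) := by
  rw [Subgroup.mem_normalizer_iff]
  intro h
  constructor
  · rintro ⟨w, rfl⟩
    exact ⟨_, (ω.extHom_conj e g w).symm⟩
  · rintro ⟨w, hw⟩
    refine ⟨ω.extConj g⁻¹ w, ?_⟩
    rw [← extHom_conj, hw, map_inv]
    group

/-- The map `S ⋊ ∏ S_{d_i} → N_{S_n}(S)`. -/
def extToNormalizer :
    ω.Ext →* Subgroup.normalizer (ω.subgroupS e : Set (Equiv.Perm (Fin n))) :=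
  (ω.extHom e).codRestrict _ (ω.extHom_mem_normalizer e)

theorem extRep_repS (g : ω.Ext) (s : ω.subgroupS e) :
    ω.extRep ρ g * ω.repS ρ e s =
      ω.repS ρ e ((ω.subgroupS e).normalizerMonoidHom (ω.extToNormalizer e g) s) *
        ω.extRep ρ g := by
  obtain ⟨w, rfl⟩ := (ω.baseEquiv e).surjective s
  have h : (ω.subgroupS e).normalizerMonoidHom (ω.extToNormalizer e g) (ω.baseEquiv e w) =
      ω.baseEquiv e (ω.extConj g w) := by
    apply Subtype.ext
    exact ω.extHom_conj e g w
  rw [h]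
  simpa [repS] using ω.extRep_baseRep ρ g w

theorem extToNormalizer_mem (g : ω.Ext) :
    ω.extToNormalizer e g ∈ stabN (ω.subgroupS e) (ω.repS ρ e) := by
  refine ⟨Representation.Equiv.mk (LinearEquiv.ofLinearMap (ω.extRep ρ g) (ω.extRep ρ g⁻¹)
    ?_ ?_) ?_⟩
  · change ω.extRep ρ g * ω.extRep ρ g⁻¹ = 1
    rw [← map_mul, mul_inv_cancel, map_one]
  · change ω.extRep ρ g⁻¹ * ω.extRep ρ g = 1
    rw [← map_mul, inv_mul_cancel, map_one]
  · intro s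
    have h := ω.extRep_repS ρ e g
      (((ω.subgroupS e).normalizerMonoidHom (ω.extToNormalizer e g))⁻¹ s)
    rw [MulAut.apply_inv_self] at h
    exact h

/-- The map `S ⋊ ∏ S_{d_i} → N_{S_n}(S, ρ)`. -/
def extToN : ω.Ext →* stabN (ω.subgroupS e) (ω.repS ρ e) :=
  (ω.extToNormalizer e).codRestrict _ (ω.extToNormalizer_mem ρ e)

/-- The element of `∏ S_{d_i}` which acts on `(S_{|ω^i|})^{d_i}` by circular permutation of the
coordinates, `(g_1, …, g_d) ↦ (g_2, …, g_d, g_1)`, for all `i`. -/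
def circ : ω.Top := fun i => (finRotate (ω.deg i))⁻¹

/-- The element `v` of `W_{S_n}(S, ρ)`, circular permutation on each `(S_{|ω^i|})^{d_i}`. -/
def v : stabW (ω.subgroupS e) (ω.repS ρ e) :=
  QuotientGroup.mk (ω.extToN ρ e (SemidirectProduct.inr ω.circ))

/-! ### The action on `Hom_{S_n}(Ind_S^{S_n} V_ω, W)` -/

/-- The induced representation `Ind_S^{S_n}(V_ω)`. In Mathlib it is the space of `S`-coinvariants
`(κ[S_n] ⊗ V_ω)_S`, in which `x ⊗ u` stands for `x⁻¹ ⊗ u` of `κ[S_n] ⊗_{κ[S]} V_ω`. -/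
abbrev indRep : Representation κ (Equiv.Perm (Fin n))
    (Representation.IndV (ω.subgroupS e).subtype (ω.repS ρ e)) :=
  Representation.ind (ω.subgroupS e).subtype (ω.repS ρ e)

/-- The operator `y ⊗ u ↦ t y ⊗ t · u` on `κ[S_n] ⊗ V_ω`. -/
def extTensor (t : ω.Ext) :
    Module.End κ (MonoidAlgebra κ (Equiv.Perm (Fin n)) ⊗[κ] ω.VSpace κ V) :=
  TensorProduct.map (Representation.leftRegular κ (Equiv.Perm (Fin n)) (ω.extHom e t))
    (ω.extRep ρ t)

theorem extTensor_mul (t t' : ω.Ext) :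
    ω.extTensor ρ e (t * t') = ω.extTensor ρ e t * ω.extTensor ρ e t' := by
  simp only [extTensor, map_mul, TensorProduct.map_mul]

theorem extTensor_one : ω.extTensor (V := V) ρ e 1 = 1 := by
  simp only [extTensor, map_one, TensorProduct.map_one]

theorem extTensor_comm (t : ω.Ext) (s : ω.subgroupS e) :
    ω.extTensor ρ e t *
        Representation.tprod ((Representation.leftRegular κ (Equiv.Perm (Fin n))).comp
          (ω.subgroupS e).subtype) (ω.repS ρ e) s =
      Representation.tprod ((Representation.leftRegular κ (Equiv.Perm (Fin n))).comp
          (ω.subgroupS e).subtype) (ω.repS ρ e)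
          ((ω.subgroupS e).normalizerMonoidHom (ω.extToNormalizer e t) s) *
        ω.extTensor ρ e t := by
  have h1 : (((ω.subgroupS e).normalizerMonoidHom (ω.extToNormalizer e t) s : ω.subgroupS e) :
      Equiv.Perm (Fin n)) = ω.extHom e t * s * (ω.extHom e t)⁻¹ := rfl
  simp only [extTensor, Representation.tprod_apply, ← TensorProduct.map_mul, extRep_repS,
    MonoidHom.comp_apply, Subgroup.subtype_apply, h1, ← map_mul, inv_mul_cancel_right]

/-- The action of `t ∈ S ⋊ ∏ S_{d_i}` on `Ind_S^{S_n}(V_ω)`; it is `x ⊗ u ↦ x t⁻¹ ⊗ t · u` on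
`κ[S_n] ⊗_{κ[S]} V_ω`, that is, `y ⊗ u ↦ t y ⊗ t · u` on the coinvariants (with `y = x⁻¹`). -/
def extInd (t : ω.Ext) :
    Module.End κ (Representation.IndV (ω.subgroupS e).subtype (ω.repS ρ e)) :=
  Representation.Coinvariants.lift _
    (Representation.Coinvariants.mk _ ∘ₗ ω.extTensor ρ e t) fun s => by
      refine LinearMap.ext fun x => ?_
      have h := LinearMap.congr_fun (ω.extTensor_comm ρ e t s) x
      simp only [Module.End.mul_apply] at h
      simp only [LinearMap.comp_apply, h, Representation.Coinvariants.mk_self_apply]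

theorem extInd_mul (t t' : ω.Ext) :
    ω.extInd ρ e (t * t') = ω.extInd ρ e t * ω.extInd ρ e t' := by
  refine Representation.Coinvariants.hom_ext (LinearMap.ext fun x => ?_)
  exact congrArg (Representation.Coinvariants.mk _)
    (LinearMap.congr_fun (ω.extTensor_mul ρ e t t') x)

theorem extInd_one : ω.extInd (V := V) ρ e 1 = 1 := by
  refine Representation.Coinvariants.hom_ext (LinearMap.ext fun x => ?_)
  exact congrArg (Representation.Coinvariants.mk _)
    (LinearMap.congr_fun (ω.extTensor_one ρ e) x)

theorem extInd_mk (t : ω.Ext) (y : Equiv.Perm (Fin n)) (u : ω.VSpace κ V) :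
    ω.extInd ρ e t (Representation.IndV.mk (ω.subgroupS e).subtype (ω.repS ρ e) y u) =
      Representation.IndV.mk (ω.subgroupS e).subtype (ω.repS ρ e) (ω.extHom e t * y)
        (ω.extRep ρ t u) := by
  simp [extInd, extTensor]

/-- The action on `Ind_S^{S_n}(V_ω)` commutes with `S_n`. -/
def extIndMap (t : ω.Ext) :
    Representation.IntertwiningMap (ω.indRep ρ e) (ω.indRep ρ e) where
  toLinearMap := ω.extInd ρ e t
  isIntertwining' g := by
    refine Representation.IndV.hom_ext _ _ fun h => LinearMap.ext fun x => ?_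
    change ω.extInd ρ e t (ω.indRep ρ e g (Representation.IndV.mk _ _ h x)) =
      ω.indRep ρ e g (ω.extInd ρ e t (Representation.IndV.mk _ _ h x))
    rw [Representation.ind_mk, extInd_mk, extInd_mk, Representation.ind_mk, mul_assoc]

variable {M : Type*} [AddCommGroup M] [Module κ M]
  (τ : Representation κ (Equiv.Perm (Fin n)) M)

/-- The action of `S ⋊ ∏ S_{d_i}` on `Hom_{S_n}(Ind_S^{S_n}(V_ω), M)`:
`(t · f)(z) = f (t⁻¹ · z)`. -/
def homRep : Representation κ ω.Ext (Representation.IntertwiningMap (ω.indRep ρ e) τ) where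
  toFun t :=
    { toFun := fun f => f.comp (ω.extIndMap ρ e t⁻¹)
      map_add' := fun _ _ => rfl
      map_smul' := fun _ _ => rfl }
  map_one' := by
    refine LinearMap.ext fun f => Representation.IntertwiningMap.ext (LinearMap.ext fun z => ?_)
    change f (ω.extInd ρ e 1⁻¹ z) = f z
    rw [inv_one, extInd_one]
    rfl
  map_mul' t t' := by
    refine LinearMap.ext fun f => Representation.IntertwiningMap.ext (LinearMap.ext fun z => ?_)
    change f (ω.extInd ρ e (t * t')⁻¹ z) = f (ω.extInd ρ e t'⁻¹ (ω.extInd ρ e t⁻¹ z))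
    rw [mul_inv_rev, extInd_mul]
    rfl

end PType

end TwistedLR

end

noncomputable section

namespace TwistedLR

/-!
Both sides of the trace identity are the same average over `S`.

For a permutation `g` of a finite set `X` let `p_g` be its power sum, realised as the generating
series of the maps `X → ℕ` that are constant on the cycles of `g`. The coefficients of `p_g` are the
values at `g` of Young permutation characters, so `χ^λ(g)` is the value at `p_g` of the linear
functional `f ↦ ∑ₛ sgn(s) [x^(λ - δ + s δ)] f`, where `δ = (0, 1, 2, …)`. By Burnside's lemma and
the Jacobi–Trudi identity, `n! s_λ = ∑_g χ^λ(g) p_g`; the functional vanishes on `s_μ` for `μ ≠ λ`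
and is `1` on `s_λ`.

Substituting `x ↦ x^d` in `p_h` gives `p_g` for every permutation `g` of `X × {1, …, d}` that moves
the `d` copies of `X` in a circle with cycle product `h`. Hence, with `v` acting by circular
permutations, `|S| ∏ᵢ s_{ωⁱ}(x^{dᵢ}) = ∑_{w ∈ S} ∏ᵢ χ^{ωⁱ}(cycle products of w) p_{w v}`, and the
functional turns this into `|S| c_ω^μ = ∑_{w ∈ S} ∏ᵢ χ^{ωⁱ}(cycle products of w) χ^μ(w v)`.

On the other side, Frobenius reciprocity identifies the space of homomorphisms with the
`S`-invariants of `Hom(V_ω, V_μ)`, so that the trace of `v` is the average over the coset `S v` of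
the product of two characters, and a circular permutation composed with a tensor product of
operators has as trace the trace of the product of these operators.
-/

/-! ### Generating series of weighted types -/

section WeightSeries

variable (R : Type*) [CommSemiring R] {σ τ A B : Type*}

/-- The generating series `∑ x^(wt a)` of a type `A` with a weight function `wt`. It is meaningful
when `FiniteFibres wt` holds: an exponent which is the weight of infinitely many elements gets the
coefficient `0`. -/
def weightSeries (wt : A → σ →₀ ℕ) : MvPowerSeries σ R :=
  fun m => (Nat.card {a // wt a = m} : R)

/-- A function taking every value finitely often: the condition under which the weighted type has a
generating series. -/
def FiniteFibres (wt : A → τ) : Prop := ∀ m, Finite {a // wt a = m}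

theorem FiniteFibres.comp_injective {wt : A → τ} (h : FiniteFibres wt) {f : B → A}
    (hf : Function.Injective f) : FiniteFibres fun b => wt (f b) := fun m =>
  have := h m
  Finite.of_injective (fun b => ⟨f b.1, b.2⟩ : {b : B // wt (f b) = m} → {a // wt a = m})
    fun _ _ hab => Subtype.ext (hf (Subtype.mk.inj hab))

theorem FiniteFibres.injective_comp {wt : A → τ} (h : FiniteFibres wt) {f : τ → B}
    (hf : Function.Injective f) : FiniteFibres fun a => f (wt a) := by
  intro m
  by_cases hm : ∃ m', f m' = m
  · obtain ⟨m', rfl⟩ := hm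
    have := h m'
    exact Finite.of_equiv _ (Equiv.subtypeEquivRight fun a => hf.eq_iff).symm
  · have : IsEmpty {a // f (wt a) = m} := ⟨fun a => hm ⟨wt a.1, a.2⟩⟩
    infer_instance

theorem finiteFibres_of_injective {wt : A → τ} (h : Function.Injective wt) : FiniteFibres wt :=
  fun m =>
    have : Subsingleton {a // wt a = m} := ⟨fun a b => Subtype.ext (h (a.2.trans b.2.symm))⟩
    inferInstance

variable {R} in
theorem coeff_weightSeries (wt : A → σ →₀ ℕ) (m : σ →₀ ℕ) :
    MvPowerSeries.coeff m (weightSeries R wt) = (Nat.card {a // wt a = m} : R) := rfl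

theorem coeff_weightSeries_subtype_val (p : (σ →₀ ℕ) → Prop) [DecidablePred p] (m : σ →₀ ℕ) :
    MvPowerSeries.coeff m (weightSeries R (Subtype.val : Subtype p → σ →₀ ℕ)) =
      if p m then 1 else 0 := by
  rw [coeff_weightSeries]
  split_ifs with h
  · have : Unique {a : Subtype p // a.1 = m} :=
      ⟨⟨⟨⟨m, h⟩, rfl⟩⟩, fun a => Subtype.ext (Subtype.ext a.2)⟩
    rw [Nat.card_unique, Nat.cast_one]
  · have : IsEmpty {a : Subtype p // a.1 = m} := ⟨fun a => h (a.2 ▸ a.1.2)⟩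
    rw [Nat.card_of_isEmpty, Nat.cast_zero]

theorem weightSeries_congr {wt : A → σ →₀ ℕ} {wt' : B → σ →₀ ℕ} (e : A ≃ B)
    (h : ∀ a, wt' (e a) = wt a) : weightSeries R wt = weightSeries R wt' := by
  ext m
  rw [coeff_weightSeries, coeff_weightSeries]
  exact congrArg _ (Nat.card_congr (e.subtypeEquiv fun a => by rw [h]))

theorem weightSeries_zero_of_unique [Unique A] :
    weightSeries R (fun _ : A => (0 : σ →₀ ℕ)) = 1 := by
  classical
  ext m
  rw [coeff_weightSeries, MvPowerSeries.coeff_one]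
  split_ifs with hm
  · simp [hm]
  · have : IsEmpty {_a : A // (0 : σ →₀ ℕ) = m} := ⟨fun a => hm a.2.symm⟩
    rw [Nat.card_of_isEmpty, Nat.cast_zero]

theorem weightSeries_of_isEmpty [IsEmpty A] (wt : A → σ →₀ ℕ) : weightSeries R wt = 0 := by
  ext m
  rw [coeff_weightSeries, Nat.card_of_isEmpty, Nat.cast_zero, map_zero]

theorem monomial_mul_weightSeries (n : σ →₀ ℕ) (wt : A → σ →₀ ℕ) :
    MvPowerSeries.monomial n 1 * weightSeries R wt = weightSeries R fun a => n + wt a := by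
  classical
  ext m
  rw [MvPowerSeries.coeff_monomial_mul, one_mul, coeff_weightSeries, coeff_weightSeries]
  split_ifs with h
  · obtain ⟨m', rfl⟩ := exists_add_of_le h
    rw [add_tsub_cancel_left,
      Nat.card_congr (Equiv.subtypeEquivRight fun a => (add_right_inj n).symm)]
  · have : IsEmpty {a // n + wt a = m} := ⟨fun a => h (a.2 ▸ le_self_add)⟩
    rw [Nat.card_of_isEmpty, Nat.cast_zero]

theorem weightSeries_sigma {ι : Type*} [Fintype ι] {A : ι → Type*} {wt : ∀ i, A i → σ →₀ ℕ}
    (h : ∀ i, FiniteFibres (wt i)) :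
    weightSeries R (fun a : Σ i, A i => wt a.1 a.2) = ∑ i, weightSeries R (wt i) := by
  ext m
  let e : {a : Σ i, A i // wt a.1 a.2 = m} ≃ Σ i, {a : A i // wt i a = m} :=
    { toFun := fun a => ⟨a.1.1, a.1.2, a.2⟩
      invFun := fun a => ⟨⟨a.1, a.2.1⟩, a.2.2⟩
      left_inv := fun _ => rfl
      right_inv := fun _ => rfl }
  have := fun i => h i m
  rw [coeff_weightSeries, Nat.card_congr e, Nat.card_sigma, map_sum]
  simp only [coeff_weightSeries, Nat.cast_sum]

/-- Families of total weight `m`, sorted by the weights of their members. -/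
def piFibreEquiv [DecidableEq σ] {ι : Type*} [Fintype ι] [DecidableEq ι] {A : ι → Type*}
    (wt : ∀ i, A i → σ →₀ ℕ) (m : σ →₀ ℕ) :
    {a : ∀ i, A i // ∑ i, wt i (a i) = m} ≃
      Σ l : Finset.univ.finsuppAntidiag m, ∀ i, {x : A i // wt i x = l.1 i} where
  toFun a := ⟨⟨Finsupp.equivFunOnFinite.symm fun i => wt i (a.1 i),
    Finset.mem_finsuppAntidiag.2 ⟨a.2, Finset.subset_univ _⟩⟩, fun i => ⟨a.1 i, rfl⟩⟩
  invFun p := ⟨fun i => (p.2 i).1, by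
    simpa only [fun i => (p.2 i).2] using (Finset.mem_finsuppAntidiag.1 p.1.2).1⟩
  left_inv _ := rfl
  right_inv := by
    rintro ⟨⟨l, hl⟩, a⟩
    obtain ⟨⟨x, hx⟩, rfl⟩ := (Equiv.subtypePiEquivPi (p := fun i y => wt i y = l i)).surjective a
    obtain rfl : Finsupp.equivFunOnFinite.symm (fun i => wt i (x i)) = l := Finsupp.ext hx
    rfl

theorem prod_weightSeries {ι : Type*} [Fintype ι] {A : ι → Type*} {wt : ∀ i, A i → σ →₀ ℕ}
    (h : ∀ i, FiniteFibres (wt i)) :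
    ∏ i, weightSeries R (wt i) = weightSeries R fun a : ∀ i, A i => ∑ i, wt i (a i) := by
  classical
  ext m
  have (l : ι →₀ σ →₀ ℕ) (i : ι) := h i (l i)
  rw [MvPowerSeries.coeff_prod, coeff_weightSeries, Nat.card_congr (piFibreEquiv wt m),
    Nat.card_sigma, ← Finset.sum_coe_sort]
  simp only [coeff_weightSeries, Nat.card_pi, Nat.cast_sum, Nat.cast_prod]

theorem expand_weightSeries {R : Type*} [CommRing R] (wt : A → σ →₀ ℕ) {d : ℕ} (hd : d ≠ 0) :
    MvPowerSeries.expand d hd (weightSeries R wt) = weightSeries R fun a => d • wt a := by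
  ext m
  by_cases hm : ∀ i, d ∣ m i
  · obtain ⟨m', rfl⟩ : ∃ m', m = d • m' := by
      refine ⟨m.mapRange (· / d) (Nat.zero_div d), Finsupp.ext fun i => ?_⟩
      exact (Nat.mul_div_cancel' (hm i)).symm
    rw [MvPowerSeries.coeff_expand_smul, coeff_weightSeries, coeff_weightSeries]
    exact congrArg _ (Nat.card_congr
      (Equiv.subtypeEquivRight fun a => (nsmul_right_injective hd).eq_iff.symm))
  · push Not at hm
    obtain ⟨i, hi⟩ := hm
    have : IsEmpty {a // d • wt a = m} := ⟨fun a => hi (a.2 ▸ ⟨wt a.1 i, rfl⟩)⟩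
    rw [MvPowerSeries.coeff_expand_of_not_dvd _ _ _ hi, coeff_weightSeries, Nat.card_of_isEmpty,
      Nat.cast_zero]

end WeightSeries

/-! ### Contents of maps and power sums -/

section Content

variable {X Y σ : Type*} [Fintype X] [Fintype Y]

/-- The content of a map `f`: the sizes of its fibres. It is the exponent of the monomial
`∏ x_(f x)`. -/
def content (f : X → σ) : σ →₀ ℕ := ∑ x, Finsupp.single (f x) 1

theorem content_apply (f : X → σ) (j : σ) : content f j = Nat.card {x // f x = j} := by
  classical
  rw [content, Finsupp.finsetSum_apply, Nat.card_eq_fintype_card, Fintype.card_subtype,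
    Finset.card_filter]
  simp only [Finsupp.single_apply]

theorem content_comp_equiv (f : X → σ) (e : Y ≃ X) : content (f ∘ e) = content f :=
  Fintype.sum_equiv e _ _ fun _ => rfl

theorem content_comp_left_equiv {σ' : Type*} (f : X → σ) (τ : σ ≃ σ') :
    content (τ ∘ f) = (content f).equivMapDomain τ := by
  ext j
  rw [Finsupp.equivMapDomain_apply, content_apply, content_apply]
  exact Nat.card_congr (Equiv.subtypeEquivRight fun x => (Equiv.eq_symm_apply τ).symm)

theorem content_apply_self_ne_zero (f : X → σ) (x : X) : content f (f x) ≠ 0 := by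
  rw [content_apply]
  have : Nonempty {y // f y = f x} := ⟨⟨x, rfl⟩⟩
  exact Nat.card_pos.ne'

theorem degree_content (f : X → σ) : (content f).degree = Fintype.card X := by
  simp [content]

theorem finiteFibres_content : FiniteFibres (content : (X → σ) → σ →₀ ℕ) := by
  intro m
  refine Finite.of_injective
    (fun f x => ⟨f.1 x, ?_⟩ : {f : X → σ // content f = m} → X → m.support) fun f f' h => ?_
  · obtain ⟨f, rfl⟩ := f
    exact Finsupp.mem_support_iff.2 (content_apply_self_ne_zero f x)
  · ext x
    exact congrArg Subtype.val (congrFun h x)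

/-- The power sum attached to the cycle type of a permutation `g`, as the generating series of the
maps to `ℕ` which are constant on the cycles of `g`. -/
def fixSeries (g : Equiv.Perm X) : MvPowerSeries ℕ ℤ :=
  weightSeries ℤ fun f : {f : X → ℕ // ∀ x, f (g x) = f x} => content f.1

theorem coeff_fixSeries (g : Equiv.Perm X) (m : ℕ →₀ ℕ) :
    MvPowerSeries.coeff m (fixSeries g) =
      (Nat.card {f : X → ℕ // (∀ x, f (g x) = f x) ∧ content f = m} : ℤ) :=
  congrArg _ (Nat.card_congr (Equiv.subtypeSubtypeEquivSubtypeInter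
    (fun f : X → ℕ => ∀ x, f (g x) = f x) fun f => content f = m))

theorem fixSeries_permCongr (e : X ≃ Y) (g : Equiv.Perm X) :
    fixSeries (e.permCongr g) = fixSeries g :=
  (weightSeries_congr ℤ ((e.arrowCongr (Equiv.refl ℕ)).subtypeEquiv fun f =>
    e.forall_congr fun x => by simp) fun f => content_comp_equiv f.1 e.symm).symm

theorem fixSeries_inv (g : Equiv.Perm X) : fixSeries g⁻¹ = fixSeries g :=
  weightSeries_congr ℤ (Equiv.subtypeEquivRight fun f =>
    g.symm.forall_congr fun x => by simp [eq_comm]) fun _ => rfl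

end Content

/-! ### The functionals dual to the Schur functions -/

section SchurCoord

variable {R : Type*} [CommSemiring R] {X : Type*} [Fintype X] {l : ℕ}

/-- The exponent `(a_0, …, a_(l-1), 0, 0, …)`. Negative `a_i` are replaced by `0`. -/
def natExponent (a : Fin l → ℤ) : ℕ →₀ ℕ := ∑ i : Fin l, Finsupp.single (i : ℕ) (a i).toNat

theorem natExponent_apply (a : Fin l → ℤ) (i : Fin l) : natExponent a i = (a i).toNat := by
  rw [natExponent, Finsupp.finsetSum_apply, Finset.sum_eq_single i]
  · exact Finsupp.single_eq_same
  · exact fun j _ hj => Finsupp.single_eq_of_ne fun h => hj (Fin.ext h.symm)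
  · exact fun hi => absurd (Finset.mem_univ i) hi

theorem natExponent_apply_of_le (a : Fin l → ℤ) {j : ℕ} (hj : l ≤ j) : natExponent a j = 0 := by
  rw [natExponent, Finsupp.finsetSum_apply]
  exact Finset.sum_eq_zero fun i _ => Finsupp.single_eq_of_ne (by omega)

open Classical in
/-- The coefficient of `x_0^(a_0) ⋯ x_(l-1)^(a_(l-1))`, taken to be zero if some `a_i` is
negative. -/
def intCoeff (a : Fin l → ℤ) : MvPowerSeries ℕ R →ₗ[R] R :=
  if ∀ i, 0 ≤ a i then MvPowerSeries.coeff (natExponent a) else 0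

theorem intCoeff_of_nonneg {a : Fin l → ℤ} (ha : ∀ i, 0 ≤ a i) (F : MvPowerSeries ℕ R) :
    intCoeff a F = MvPowerSeries.coeff (natExponent a) F := by
  rw [intCoeff, if_pos ha]

theorem intCoeff_of_neg {a : Fin l → ℤ} {i : Fin l} (hi : a i < 0) (F : MvPowerSeries ℕ R) :
    intCoeff a F = 0 := by
  rw [intCoeff, if_neg fun h => absurd (h i) (not_le.2 hi), LinearMap.zero_apply]

theorem content_val_eq_natExponent_iff {a : Fin l → ℤ} (ha : ∀ i, 0 ≤ a i) (f : X → Fin l) :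
    content (fun x => (f x : ℕ)) = natExponent a ↔
      ∀ j, (Nat.card {x : X // f x = j} : ℤ) = a j := by
  have hfib (j : Fin l) : content (fun x => (f x : ℕ)) j = Nat.card {x // f x = j} := by
    rw [content_apply]
    exact Nat.card_congr (Equiv.subtypeEquivRight fun x => Fin.ext_iff.symm)
  constructor
  · intro h j
    rw [← hfib, h, natExponent_apply, Int.toNat_of_nonneg (ha j)]
  · intro h
    ext j
    by_cases hj : j < l
    · rw [hfib ⟨j, hj⟩, natExponent_apply a ⟨j, hj⟩, ← h, Int.toNat_natCast]
    · have : IsEmpty {x // (f x : ℕ) = j} := ⟨fun x => hj (x.2 ▸ (f x.1).2)⟩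
      rw [natExponent_apply_of_le a (not_lt.1 hj), content_apply, Nat.card_of_isEmpty]

/-- A map of content `a` to `ℕ` takes its values below the length of `a`. -/
def finFunctionEquiv {a : Fin l → ℤ} (ha : ∀ i, 0 ≤ a i) (g : Equiv.Perm X) :
    {f : X → Fin l // (∀ x, f (g x) = f x) ∧ ∀ j, (Nat.card {x : X // f x = j} : ℤ) = a j} ≃
      {f : X → ℕ // (∀ x, f (g x) = f x) ∧ content f = natExponent a} where
  toFun f := ⟨fun x => (f.1 x : ℕ), fun x => congrArg Fin.val (f.2.1 x),
    (content_val_eq_natExponent_iff ha f.1).2 f.2.2⟩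
  invFun f :=
    have hl (x : X) : f.1 x < l := by
      by_contra hx
      refine content_apply_self_ne_zero f.1 x ?_
      rw [f.2.2, natExponent_apply_of_le a (not_lt.1 hx)]
    ⟨fun x => ⟨f.1 x, hl x⟩, fun x => Fin.ext (f.2.1 x),
      (content_val_eq_natExponent_iff ha _).1 f.2.2⟩
  left_inv _ := rfl
  right_inv _ := rfl

theorem youngPermChar_eq_intCoeff (a : Fin l → ℤ) (g : Equiv.Perm X) :
    youngPermChar a g = intCoeff a (fixSeries g) := by
  rw [youngPermChar]
  by_cases ha : ∀ i, 0 ≤ a i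
  · rw [intCoeff_of_nonneg ha, coeff_fixSeries]
    exact congrArg _ (Nat.card_congr (finFunctionEquiv ha g))
  · push Not at ha
    obtain ⟨i, hi⟩ := ha
    have : IsEmpty {f : X → Fin l // (∀ x, f (g x) = f x) ∧
        ∀ j, (Nat.card {x : X // f x = j} : ℤ) = a j} :=
      ⟨fun f => hi.not_ge (f.2.2 i ▸ Int.natCast_nonneg _)⟩
    rw [intCoeff_of_neg hi, Nat.card_of_isEmpty, Nat.cast_zero]

/-- The exponent `lam - δ + s(δ)`, with `δ = (0, 1, 2, …)`. -/
def shiftedParts (lam : YoungDiagram) (s : Equiv.Perm (Fin (lam.colLen 0))) :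
    Fin (lam.colLen 0) → ℤ :=
  fun i => (lam.rowLen (i : ℕ) : ℤ) - ((i : ℕ) : ℤ) + ((s i : ℕ) : ℤ)

/-- The linear functional which extracts the coefficient of `s_lam` from a symmetric function: it is
dual to the Jacobi–Trudi expansion of `s_lam`, since the `h_a` are dual to the monomials. -/
def schurCoord (lam : YoungDiagram) : MvPowerSeries ℕ ℤ →ₗ[ℤ] ℤ :=
  ∑ s : Equiv.Perm (Fin (lam.colLen 0)), (Equiv.Perm.sign s : ℤ) • intCoeff (shiftedParts lam s)

theorem schurCoord_apply (lam : YoungDiagram) (F : MvPowerSeries ℕ ℤ) :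
    schurCoord lam F = ∑ s : Equiv.Perm (Fin (lam.colLen 0)),
      (Equiv.Perm.sign s : ℤ) * intCoeff (shiftedParts lam s) F :=
  LinearMap.sum_apply _ _ _

theorem chi_eq_schurCoord (lam : YoungDiagram) (g : Equiv.Perm X) :
    chi lam g = schurCoord lam (fixSeries g) := by
  simp only [schurCoord_apply, chi, youngPermChar_eq_intCoeff]
  rfl

theorem chi_inv (lam : YoungDiagram) (g : Equiv.Perm X) : chi lam g⁻¹ = chi lam g := by
  rw [chi_eq_schurCoord, chi_eq_schurCoord, fixSeries_inv]

theorem chi_permCongr {Y : Type*} [Fintype Y] (lam : YoungDiagram) (e : X ≃ Y)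
    (g : Equiv.Perm X) : chi lam (e.permCongr g) = chi lam g := by
  rw [chi_eq_schurCoord, chi_eq_schurCoord, fixSeries_permCongr]

end SchurCoord

/-! ### Young diagrams and their rows -/

section Diagrams

theorem youngDiagram_ext_rowLen {mu nu : YoungDiagram} (h : ∀ i, mu.rowLen i = nu.rowLen i) :
    mu = nu := by
  ext ⟨i, j⟩
  rw [YoungDiagram.mem_cells, YoungDiagram.mem_cells, YoungDiagram.mem_iff_lt_rowLen,
    YoungDiagram.mem_iff_lt_rowLen, h]

theorem rowLen_mono (i : ℕ) : Monotone fun mu : YoungDiagram => mu.rowLen i := fun _ _ h =>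
  le_of_forall_lt fun _ hj => YoungDiagram.mem_iff_lt_rowLen.1
    (h (YoungDiagram.mem_iff_lt_rowLen.2 hj))

theorem rowLen_eq_zero_of_le {mu : YoungDiagram} {L i : ℕ} (hL : mu.rowLen L = 0) (hi : L ≤ i) :
    mu.rowLen i = 0 :=
  Nat.le_zero.1 (hL ▸ mu.rowLen_anti L i hi)

theorem rowLen_colLen (mu : YoungDiagram) : mu.rowLen (mu.colLen 0) = 0 := by
  by_contra h
  have hmem : (mu.colLen 0, 0) ∈ mu := YoungDiagram.mem_iff_lt_rowLen.2 (Nat.pos_of_ne_zero h)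
  exact lt_irrefl _ (YoungDiagram.mem_iff_lt_colLen.1 hmem)

theorem card_filter_lt_eq_sum {A : Type*} (s : Finset A) (f : A → ℕ) (k : ℕ) :
    (s.filter fun c => f c < k).card = ∑ j ∈ Finset.range k, (s.filter fun c => f c = j).card := by
  rw [Finset.card_eq_sum_card_fiberwise (f := f) (t := Finset.range k)
    fun c hc => Finset.mem_coe.2 (Finset.mem_range.2 (Finset.mem_filter.1 hc).2)]
  refine Finset.sum_congr rfl fun j hj => ?_
  rw [Finset.filter_filter]
  refine congrArg _ (Finset.filter_congr fun c _ => and_iff_right_of_imp ?_)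
  rintro rfl
  exact Finset.mem_range.1 hj

theorem card_filter_row_lt (mu : YoungDiagram) (k : ℕ) :
    (mu.cells.filter fun c => c.1 < k).card = ∑ i ∈ Finset.range k, mu.rowLen i :=
  (card_filter_lt_eq_sum _ _ k).trans
    (Finset.sum_congr rfl fun _ _ => (YoungDiagram.rowLen_eq_card mu).symm)

theorem card_eq_sum_rowLen {mu : YoungDiagram} {L : ℕ} (hL : mu.rowLen L = 0) :
    mu.card = ∑ i ∈ Finset.range L, mu.rowLen i := by
  rw [← card_filter_row_lt, Finset.filter_true_of_mem]
  rintro ⟨i, j⟩ h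
  by_contra hi
  rw [YoungDiagram.mem_cells, YoungDiagram.mem_iff_lt_rowLen,
    rowLen_eq_zero_of_le hL (not_lt.1 hi)] at h
  exact Nat.not_lt_zero j h

/-- The Young diagram with rows of lengths `b 0 ≥ b 1 ≥ ⋯ ≥ b (L - 1)`. -/
def diagramOfRows (b : ℕ → ℕ) (hb : Antitone b) (L : ℕ) : YoungDiagram where
  cells := (Finset.range L ×ˢ Finset.range (b 0)).filter fun c => c.2 < b c.1
  isLowerSet := by
    rintro ⟨i, j⟩ ⟨i', j'⟩ ⟨hi, hj⟩ h
    simp only [Finset.coe_filter, Finset.mem_product, Finset.mem_range, Set.mem_ofPred_eq] at h ⊢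
    simp only at hi hj
    have := hb hi
    omega

theorem rowLen_diagramOfRows (b : ℕ → ℕ) (hb : Antitone b) (L : ℕ) (hL : b L = 0) (i : ℕ) :
    (diagramOfRows b hb L).rowLen i = b i := by
  refine eq_of_forall_lt_iff fun j => ?_
  rw [← YoungDiagram.mem_iff_lt_rowLen, ← YoungDiagram.mem_cells]
  simp only [diagramOfRows, Finset.mem_filter, Finset.mem_product, Finset.mem_range]
  refine ⟨fun h => h.2, fun h => ⟨⟨?_, h.trans_le (hb (Nat.zero_le i))⟩, h⟩⟩
  by_contra hi
  have := hb (not_lt.1 hi)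
  omega

end Diagrams

/-! ### Jacobi–Trudi determinants -/

section Complete

variable (R : Type*)

/-- The complete homogeneous symmetric polynomial `h_r(x_0, …, x_{k-1})`, zero for `r < 0`, as the
sum of all monomials of degree `r`. -/
def hPoly [CommSemiring R] (k : ℕ) (r : ℤ) : MvPowerSeries ℕ R :=
  weightSeries R
    (Subtype.val : {m : ℕ →₀ ℕ // (∀ j, k ≤ j → m j = 0) ∧ (m.degree : ℤ) = r} → ℕ →₀ ℕ)

open Classical in
theorem coeff_hPoly [CommSemiring R] (k : ℕ) (r : ℤ) (m : ℕ →₀ ℕ) :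
    MvPowerSeries.coeff m (hPoly R k r) =
      if (∀ j, k ≤ j → m j = 0) ∧ (m.degree : ℤ) = r then 1 else 0 :=
  coeff_weightSeries_subtype_val R _ m

theorem hPoly_of_neg [CommSemiring R] (k : ℕ) {r : ℤ} (hr : r < 0) : hPoly R k r = 0 := by
  ext m
  rw [coeff_hPoly, if_neg (by rintro ⟨-, h⟩; omega), map_zero]

theorem hPoly_zero [CommSemiring R] (r : ℤ) : hPoly R 0 r = if r = 0 then 1 else 0 := by
  classical
  ext m
  have hm : (∀ j, 0 ≤ j → m j = 0) ↔ m = 0 :=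
    ⟨fun h => Finsupp.ext fun j => h j (Nat.zero_le j), fun h => by simp [h]⟩
  rw [coeff_hPoly, apply_ite (MvPowerSeries.coeff m), MvPowerSeries.coeff_one, map_zero,
    ← ite_and]
  refine if_congr ((and_congr_left' hm).trans (and_comm.trans (and_congr_left ?_))) rfl rfl
  rintro rfl
  rw [map_zero, Nat.cast_zero, eq_comm]

theorem hPoly_succ [CommSemiring R] (k : ℕ) (r : ℤ) :
    hPoly R (k + 1) r = hPoly R k r + MvPowerSeries.X k * hPoly R (k + 1) (r - 1) := by
  classical
  ext m
  rw [map_add, MvPowerSeries.X_def, MvPowerSeries.coeff_monomial_mul, one_mul]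
  simp only [coeff_hPoly]
  have hsupp : (∀ j, k ≤ j → m j = 0) ↔ m k = 0 ∧ ∀ j, k + 1 ≤ j → m j = 0 := by
    refine ⟨fun h => ⟨h k le_rfl, fun j hj => h j (Nat.le_of_succ_le hj)⟩, fun h j hj => ?_⟩
    rcases hj.eq_or_lt with rfl | hj
    exacts [h.1, h.2 j hj]
  by_cases hk : m k = 0
  · have hle : ¬ Finsupp.single k 1 ≤ m := by simp [hk]
    rw [if_neg hle, add_zero, hsupp, and_iff_right hk]
  · obtain ⟨m', rfl⟩ : ∃ m', m = Finsupp.single k 1 + m' :=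
      exists_add_of_le (Finsupp.single_le_iff.2 (Nat.one_le_iff_ne_zero.2 hk))
    have hsupp' (j : ℕ) (hj : k + 1 ≤ j) : (Finsupp.single k 1 + m' : ℕ →₀ ℕ) j = m' j := by
      rw [Finsupp.add_apply, Finsupp.single_eq_of_ne (by omega), zero_add]
    have hdeg : ((Finsupp.single k 1 + m').degree : ℤ) = r ↔ (m'.degree : ℤ) = r - 1 := by
      rw [map_add, Finsupp.degree_single]
      push_cast
      omega
    rw [if_pos le_self_add, add_tsub_cancel_left, hsupp,
      if_neg fun h : (_ ∧ _) ∧ _ => hk h.1.1, zero_add]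
    exact if_congr (and_congr (forall₂_congr fun j hj => by rw [hsupp' j hj]) hdeg) rfl rfl

variable [CommRing R]

theorem hPoly_succ_eq_sum (k : ℕ) (c : ℤ) {a b : ℕ} (hab : b ≤ a) :
    hPoly R (k + 1) (a + c) =
      ∑ t ∈ Finset.Icc b a, MvPowerSeries.X k ^ (a - t) * hPoly R k (t + c) +
        MvPowerSeries.X k ^ (a - b + 1) * hPoly R (k + 1) (b - 1 + c) := by
  induction a, hab using Nat.le_induction with
  | base =>
    rw [Finset.Icc_self, Finset.sum_singleton, Nat.sub_self, pow_zero, one_mul, zero_add, pow_one,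
      hPoly_succ]
    ring_nf
  | succ a hab ih =>
    have hpow (t : ℕ) (ht : t ∈ Finset.Icc b a) :
        (MvPowerSeries.X k : MvPowerSeries ℕ R) ^ (a + 1 - t) * hPoly R k (t + c) =
          MvPowerSeries.X k * (MvPowerSeries.X k ^ (a - t) * hPoly R k (t + c)) := by
      rw [Nat.sub_add_comm (Finset.mem_Icc.1 ht).2, pow_succ', mul_assoc]
    rw [hPoly_succ, show ((a + 1 : ℕ) : ℤ) + c - 1 = a + c by push_cast; ring, ih,
      Finset.sum_Icc_succ_top (by omega), Nat.sub_self, pow_zero, one_mul,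
      Finset.sum_congr rfl hpow, ← Finset.mul_sum, Nat.sub_add_comm hab]
    ring

/-- The Jacobi–Trudi determinant `det (h_{a_i - i + j}(x_0, …, x_{k-1}))`. -/
def jacobiTrudi {L : ℕ} (k : ℕ) (a : Fin L → ℕ) : MvPowerSeries ℕ R :=
  (Matrix.of fun i j : Fin L => hPoly R k ((a i : ℤ) + ((j : ℕ) - (i : ℕ)))).det

theorem jacobiTrudi_zero {L : ℕ} {a : ℕ → ℕ} (ha : Antitone a) :
    jacobiTrudi R 0 (fun i : Fin L => a i) = if ∀ i < L, a i = 0 then 1 else 0 := by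
  rw [jacobiTrudi]
  split_ifs with h
  · rw [← Matrix.det_one (n := Fin L)]
    congr 1
    ext1 i j
    rw [Matrix.of_apply, h i i.2, hPoly_zero, Matrix.one_apply]
    refine if_congr ?_ rfl rfl
    rw [Fin.ext_iff]
    omega
  · push Not at h
    obtain ⟨i, hi, h⟩ := h
    have := ha (Nat.zero_le i)
    refine Matrix.det_eq_zero_of_row_eq_zero ⟨0, by omega⟩ fun j => ?_
    rw [Matrix.of_apply, hPoly_zero, if_neg]
    simp only
    omega

end Complete

section Determinants

variable {R : Type*} [CommRing R]

theorem det_eq_of_forall_row_eq_add_smul_succ {n : ℕ} {A B : Matrix (Fin (n + 1)) (Fin (n + 1)) R}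
    (c : Fin n → R) (A_last : ∀ j, A (Fin.last n) j = B (Fin.last n) j)
    (A_castSucc : ∀ i j, A (Fin.castSucc i) j = B (Fin.castSucc i) j + c i * A i.succ j) :
    A.det = B.det := by
  rw [← Matrix.det_submatrix_equiv_self Fin.revPerm A,
    ← Matrix.det_submatrix_equiv_self Fin.revPerm B]
  refine Matrix.det_eq_of_forall_row_eq_smul_add_pred (c ∘ Fin.rev) (fun j => ?_) fun i j => ?_
  · simpa using A_last j.rev
  · simpa [Fin.rev_succ, Fin.rev_castSucc] using A_castSucc i.rev j.rev

theorem det_of_sum_row {ι α : Type*} [Fintype ι] [DecidableEq ι] (s : ι → Finset α)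
    (g : ι → α → ι → R) :
    (Matrix.of fun i j => ∑ t ∈ s i, g i t j).det =
      ∑ t ∈ Fintype.piFinset s, (Matrix.of fun i j => g i (t i) j).det := by
  have hrow : (Matrix.of fun i j => ∑ t ∈ s i, g i t j) = fun i => ∑ t ∈ s i, g i t := by
    ext1 i j
    simp only [Matrix.of_apply, Finset.sum_apply]
  rw [hrow]
  exact (Matrix.detRowAlternating (n := ι) (R := R)).toMultilinearMap.map_sum_finset g s

theorem jacobiTrudi_succ (k L : ℕ) {lam : ℕ → ℕ} (hlam : Antitone lam) (hL : lam L = 0) :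
    jacobiTrudi R (k + 1) (fun i : Fin L => lam i) =
      ∑ nu ∈ Fintype.piFinset fun i : Fin L => Finset.Icc (lam (i + 1)) (lam i),
        MvPowerSeries.X k ^ (∑ i : Fin L, (lam i - nu i)) * jacobiTrudi R k nu := by
  calc
    _ = (Matrix.of fun i j : Fin L => ∑ t ∈ Finset.Icc (lam (i + 1)) (lam i),
          MvPowerSeries.X k ^ (lam i - t) * hPoly R k ((t : ℤ) + ((j : ℕ) - (i : ℕ)))).det := by
      obtain _ | L := L
      · rw [jacobiTrudi, Matrix.det_isEmpty, Matrix.det_isEmpty]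
      refine det_eq_of_forall_row_eq_add_smul_succ
        (fun i => MvPowerSeries.X k ^ (lam i - lam (i + 1) + 1)) (fun j => ?_) fun i j => ?_
      · have := j.2
        rw [Matrix.of_apply, Matrix.of_apply, hPoly_succ_eq_sum R k _ (hlam (Nat.le_succ _)),
          Fin.val_last, Nat.succ_eq_add_one, hL, hPoly_of_neg R (k + 1) (by omega), mul_zero,
          add_zero]
      · simp only [Matrix.of_apply, Fin.val_castSucc, Fin.val_succ]
        rw [hPoly_succ_eq_sum R k _ (hlam (Nat.le_succ _)), Nat.succ_eq_add_one,
          show (lam (i + 1) : ℤ) + ((j : ℕ) - (i + 1 : ℕ)) =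
            lam (i + 1) - 1 + ((j : ℕ) - (i : ℕ)) by push_cast; ring]
    _ = _ := by
      rw [det_of_sum_row]
      refine Finset.sum_congr rfl fun nu _ => ?_
      rw [← Finset.prod_pow_eq_pow_sum, jacobiTrudi, ← Matrix.det_mul_column]
      rfl

end Determinants

/-! ### The Jacobi–Trudi identity for tableaux -/

section Tableaux

variable {lam : YoungDiagram}

/-- The weight of a tableau: the number of entries equal to `k`, for each `k`. -/
def tableauWeight (T : SemistandardYoungTableau lam) : ℕ →₀ ℕ :=
  content fun c : lam.cells => T c.1.1 c.1.2

theorem tableauWeight_apply (T : SemistandardYoungTableau lam) (k : ℕ) :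
    tableauWeight T k = (lam.cells.filter fun c => T c.1 c.2 = k).card := by
  rw [tableauWeight, content, Finsupp.finsetSum_apply, Finset.card_filter]
  simp only [Finsupp.single_apply]
  exact Finset.sum_coe_sort lam.cells fun c => if T c.1 c.2 = k then 1 else 0

theorem degree_tableauWeight (T : SemistandardYoungTableau lam) :
    (tableauWeight T).degree = lam.card := by
  rw [tableauWeight, degree_content, Fintype.card_coe]

theorem schur_eq_weightSeries (lam : YoungDiagram) :
    schur lam = weightSeries ℤ (tableauWeight (lam := lam)) := by
  funext m
  refine congrArg _ (Nat.card_congr (Equiv.subtypeEquivRight fun T => ?_))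
  rw [Finsupp.ext_iff]
  exact forall_congr' fun k => by rw [tableauWeight_apply]

theorem tableau_ext_of_mem {T T' : SemistandardYoungTableau lam}
    (h : ∀ i j, (i, j) ∈ lam → T i j = T' i j) : T = T' := by
  ext i j
  by_cases hc : (i, j) ∈ lam
  · exact h i j hc
  · rw [T.zeros hc, T'.zeros hc]

theorem finiteFibres_tableauWeight (lam : YoungDiagram) :
    FiniteFibres (tableauWeight (lam := lam)) :=
  finiteFibres_content.comp_injective fun _ _ h => tableau_ext_of_mem fun i j hc =>
    congrFun h ⟨(i, j), (YoungDiagram.mem_cells _).2 hc⟩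

/-- Tableaux with entries `< k`. -/
abbrev BoundedTableau (k : ℕ) (lam : YoungDiagram) : Type :=
  {T : SemistandardYoungTableau lam // ∀ i j, (i, j) ∈ lam → T i j < k}

/-- The Schur polynomial `s_lam(x_0, …, x_{k-1})`. -/
def schurPoly (R : Type*) [CommSemiring R] (k : ℕ) (lam : YoungDiagram) : MvPowerSeries ℕ R :=
  weightSeries R fun T : BoundedTableau k lam => tableauWeight T.1

theorem coeff_schurPoly {k : ℕ} {m : ℕ →₀ ℕ} (hm : ∀ j, k ≤ j → m j = 0) (lam : YoungDiagram) :
    MvPowerSeries.coeff m (schurPoly ℤ k lam) = MvPowerSeries.coeff m (schur lam) := by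
  rw [schur_eq_weightSeries, schurPoly, coeff_weightSeries, coeff_weightSeries]
  refine congrArg _ (Nat.card_congr (Equiv.subtypeSubtypeEquivSubtype
    (p := fun T : SemistandardYoungTableau lam => ∀ i j, (i, j) ∈ lam → T i j < k)
    (q := fun T => tableauWeight T = m) fun {T} hT i j hc => ?_))
  by_contra hk
  refine content_apply_self_ne_zero (fun c : lam.cells => T c.1.1 c.1.2)
    ⟨(i, j), (YoungDiagram.mem_cells _).2 hc⟩ ?_
  exact (DFunLike.congr_fun hT _).trans (hm _ (not_lt.1 hk))

theorem schurPoly_zero (R : Type*) [CommSemiring R] (lam : YoungDiagram) :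
    schurPoly R 0 lam = if lam.card = 0 then 1 else 0 := by
  split_ifs with h
  · have hempty : IsEmpty lam.cells := Finset.isEmpty_coe_sort.2 (Finset.card_eq_zero.1 h)
    have hmem (i j : ℕ) (hc : (i, j) ∈ lam) : False :=
      hempty.false ⟨(i, j), (YoungDiagram.mem_cells _).2 hc⟩
    have : Unique (BoundedTableau 0 lam) :=
      ⟨⟨⟨default, fun i j hc => (hmem i j hc).elim⟩⟩, fun T => Subtype.ext
        (tableau_ext_of_mem fun i j hc => (hmem i j hc).elim)⟩
    have hweight (T : BoundedTableau 0 lam) : tableauWeight T.1 = 0 := by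
      rw [tableauWeight, content, Finset.univ_eq_empty, Finset.sum_empty]
    simp only [schurPoly, hweight, weightSeries_zero_of_unique]
  · obtain ⟨⟨i, j⟩, hc⟩ := Finset.card_ne_zero.1 h
    have : IsEmpty (BoundedTableau 0 lam) :=
      ⟨fun T => Nat.not_lt_zero _ (T.2 i j ((YoungDiagram.mem_cells _).1 hc))⟩
    exact weightSeries_of_isEmpty R _

/-- The diagrams `nu ⊆ lam` such that `lam / nu` is a horizontal strip. -/
abbrev Strip (lam : YoungDiagram) : Type :=
  {nu : YoungDiagram // nu ≤ lam ∧ ∀ i j, (i + 1, j) ∈ lam → (i, j) ∈ nu}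

instance (lam : YoungDiagram) : Finite (Strip lam) :=
  Finite.of_injective (fun nu => ⟨nu.1.cells, Finset.mem_powerset.2 nu.2.1⟩ :
    Strip lam → lam.cells.powerset) fun _ _ h =>
      Subtype.ext (YoungDiagram.ext (Subtype.mk.inj h))

/-- Fill the horizontal strip `lam / nu` with the entry `k`. -/
def fillStrip (k : ℕ) (nu : Strip lam) (T : BoundedTableau k nu.1) :
    BoundedTableau (k + 1) lam where
  val :=
    { entry := fun i j => if (i, j) ∈ nu.1 then T.1 i j else if (i, j) ∈ lam then k else 0
      row_weak' := by
        intro i j1 j2 hj h2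
        have h1 : (i, j1) ∈ lam := lam.up_left_mem le_rfl hj.le h2
        by_cases hn2 : (i, j2) ∈ nu.1
        · have hn1 : (i, j1) ∈ nu.1 := nu.1.up_left_mem le_rfl hj.le hn2
          rw [if_pos hn1, if_pos hn2]
          exact T.1.row_weak hj hn2
        · rw [if_neg hn2, if_pos h2]
          split_ifs with hn1
          exacts [(T.2 _ _ hn1).le, le_rfl]
      col_strict' := by
        intro i1 i2 j hi h2
        have hn1 : (i1, j) ∈ nu.1 := nu.2.2 i1 j (lam.up_left_mem hi le_rfl h2)
        rw [if_pos hn1]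
        split_ifs with hn2
        exacts [T.1.col_strict hi hn2, T.2 _ _ hn1]
      zeros' := fun h => by rw [if_neg fun hn => h (nu.2.1 hn), if_neg h] }
  property i j h := by
    change (if (i, j) ∈ nu.1 then T.1 i j else if (i, j) ∈ lam then k else 0) < k + 1
    split_ifs with hn
    exacts [(T.2 _ _ hn).trans (Nat.lt_succ_self k), Nat.lt_succ_self k]

theorem fillStrip_apply (k : ℕ) (nu : Strip lam) (T : BoundedTableau k nu.1) (i j : ℕ) :
    (fillStrip k nu T).1 i j =
      if (i, j) ∈ nu.1 then T.1 i j else if (i, j) ∈ lam then k else 0 := rfl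

theorem fillStrip_lt_iff (k : ℕ) (nu : Strip lam) (T : BoundedTableau k nu.1) {i j : ℕ}
    (h : (i, j) ∈ lam) : (fillStrip k nu T).1 i j < k ↔ (i, j) ∈ nu.1 := by
  rw [fillStrip_apply]
  split_ifs with hn
  · exact ⟨fun _ => hn, fun _ => T.2 _ _ hn⟩
  · exact ⟨fun hk => absurd hk (lt_irrefl k), fun h => absurd h hn⟩

theorem fillStrip_injective (k : ℕ) (lam : YoungDiagram) : Function.Injective
    fun p : (Σ nu : Strip lam, BoundedTableau k nu.1) => fillStrip k p.1 p.2 := by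
  rintro ⟨nu, T⟩ ⟨nu', T'⟩ h
  have hentry (i j : ℕ) : (fillStrip k nu T).1 i j = (fillStrip k nu' T').1 i j :=
    congrArg (fun S : BoundedTableau (k + 1) lam => S.1 i j) h
  obtain rfl : nu = nu' := by
    refine Subtype.ext (YoungDiagram.ext (Finset.ext ?_))
    rintro ⟨i, j⟩
    rw [YoungDiagram.mem_cells, YoungDiagram.mem_cells]
    by_cases hc : (i, j) ∈ lam
    · rw [← fillStrip_lt_iff k nu T hc, ← fillStrip_lt_iff k nu' T' hc, hentry]
    · exact ⟨fun hn => absurd (nu.2.1 hn) hc, fun hn => absurd (nu'.2.1 hn) hc⟩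
  refine Sigma.ext rfl (heq_of_eq (Subtype.ext (tableau_ext_of_mem fun i j hn => ?_)))
  have := hentry i j
  rwa [fillStrip_apply, fillStrip_apply, if_pos hn, if_pos hn] at this

/-- The diagram formed by the cells whose entries are `< k`. -/
def subshapeLT (k : ℕ) (T : SemistandardYoungTableau lam) : YoungDiagram where
  cells := lam.cells.filter fun c => T c.1 c.2 < k
  isLowerSet := by
    rintro ⟨i, j⟩ ⟨i', j'⟩ ⟨hi, hj⟩ h
    simp only [Finset.coe_filter, YoungDiagram.mem_cells, Set.mem_ofPred_eq] at h ⊢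
    exact ⟨lam.up_left_mem hi hj h.1, ((T.col_weak hi (lam.up_left_mem le_rfl hj h.1)).trans
      (T.row_weak_of_le hj h.1)).trans_lt h.2⟩

theorem mem_subshapeLT {k : ℕ} {T : SemistandardYoungTableau lam} {i j : ℕ} :
    (i, j) ∈ subshapeLT k T ↔ (i, j) ∈ lam ∧ T i j < k := by
  rw [← YoungDiagram.mem_cells, subshapeLT, Finset.mem_filter, YoungDiagram.mem_cells]

/-- The restriction of a tableau to a smaller diagram. -/
def restrictTableau {nu : YoungDiagram} (h : nu ≤ lam) (T : SemistandardYoungTableau lam) :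
    SemistandardYoungTableau nu where
  entry i j := if (i, j) ∈ nu then T i j else 0
  row_weak' hj hc := by
    rw [if_pos hc, if_pos (nu.up_left_mem le_rfl hj.le hc)]
    exact T.row_weak hj (h hc)
  col_strict' hi hc := by
    rw [if_pos hc, if_pos (nu.up_left_mem hi.le le_rfl hc)]
    exact T.col_strict hi (h hc)
  zeros' hc := if_neg hc

theorem restrictTableau_apply_of_mem {nu : YoungDiagram} (h : nu ≤ lam)
    (T : SemistandardYoungTableau lam) {i j : ℕ} (hc : (i, j) ∈ nu) :
    restrictTableau h T i j = T i j :=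
  if_pos hc

theorem fillStrip_surjective (k : ℕ) (lam : YoungDiagram) : Function.Surjective
    fun p : (Σ nu : Strip lam, BoundedTableau k nu.1) => fillStrip k p.1 p.2 := by
  rintro ⟨T, hT⟩
  have hle : subshapeLT k T ≤ lam := Finset.filter_subset _ _
  have hstrip (i j : ℕ) (h : (i + 1, j) ∈ lam) : (i, j) ∈ subshapeLT k T :=
    mem_subshapeLT.2 ⟨lam.up_left_mem (Nat.le_succ i) le_rfl h,
      (T.col_strict (Nat.lt_succ_self i) h).trans_le (Nat.lt_succ_iff.1 (hT _ _ h))⟩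
  refine ⟨⟨⟨subshapeLT k T, hle, hstrip⟩, restrictTableau hle T, fun i j hc => ?_⟩,
    Subtype.ext (tableau_ext_of_mem fun i j hc => ?_)⟩
  · rw [restrictTableau_apply_of_mem hle T hc]
    exact (mem_subshapeLT.1 hc).2
  · rw [fillStrip_apply, if_pos hc]
    split_ifs with hn
    · exact restrictTableau_apply_of_mem hle T hn
    · exact le_antisymm (not_lt.1 fun hk => hn (mem_subshapeLT.2 ⟨hc, hk⟩))
        (Nat.lt_succ_iff.1 (hT _ _ hc))

theorem tableauWeight_fillStrip (k : ℕ) (nu : Strip lam) (T : BoundedTableau k nu.1) :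
    tableauWeight (fillStrip k nu T).1 =
      Finsupp.single k (lam.card - nu.1.card) + tableauWeight T.1 := by
  have hsub : nu.1.cells ⊆ lam.cells := nu.2.1
  simp only [tableauWeight, content]
  rw [Finset.sum_coe_sort lam.cells fun c => Finsupp.single ((fillStrip k nu T).1 c.1 c.2) 1,
    Finset.sum_coe_sort nu.1.cells fun c => Finsupp.single (T.1 c.1 c.2) 1,
    ← Finset.sum_sdiff hsub]
  congr 1
  · rw [Finset.sum_congr rfl (g := fun _ => Finsupp.single k 1), Finset.sum_const,
      Finset.card_sdiff_of_subset hsub, Finsupp.smul_single, smul_eq_mul, mul_one]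
    rintro ⟨i, j⟩ hc
    rw [Finset.mem_sdiff, YoungDiagram.mem_cells, YoungDiagram.mem_cells] at hc
    rw [fillStrip_apply, if_neg hc.2, if_pos hc.1]
  · refine Finset.sum_congr rfl fun c hc => ?_
    rw [fillStrip_apply, if_pos ((YoungDiagram.mem_cells _).1 hc)]

theorem schurPoly_succ (R : Type*) [CommSemiring R] (k : ℕ) (lam : YoungDiagram)
    [Fintype (Strip lam)] :
    schurPoly R (k + 1) lam =
      ∑ nu : Strip lam, MvPowerSeries.X k ^ (lam.card - nu.1.card) * schurPoly R k nu.1 := by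
  have hinj (nu : Strip lam) : Function.Injective fun T => (fillStrip k nu T).1 := fun T T' h =>
    eq_of_heq (Sigma.mk.inj (fillStrip_injective k lam (a₁ := ⟨nu, T⟩) (a₂ := ⟨nu, T'⟩)
      (Subtype.ext h))).2
  have hfin (nu : Strip lam) : FiniteFibres fun T => tableauWeight (fillStrip k nu T).1 :=
    (finiteFibres_tableauWeight lam).comp_injective (hinj nu)
  have hstrip (nu : Strip lam) : (weightSeries R fun T => tableauWeight (fillStrip k nu T).1) =
      MvPowerSeries.X k ^ (lam.card - nu.1.card) * schurPoly R k nu.1 := by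
    simp only [tableauWeight_fillStrip, schurPoly, MvPowerSeries.X_pow_eq,
      monomial_mul_weightSeries]
  have hfill : schurPoly R (k + 1) lam = weightSeries R
      fun p : (Σ nu : Strip lam, BoundedTableau k nu.1) => tableauWeight (fillStrip k p.1 p.2).1 :=
    (weightSeries_congr R (Equiv.ofBijective _
      ⟨fillStrip_injective k lam, fillStrip_surjective k lam⟩) fun _ => rfl).symm
  exact hfill.trans ((weightSeries_sigma R hfin).trans (Finset.sum_congr rfl fun nu _ => hstrip nu))

end Tableaux

section JacobiTrudi

variable {lam : YoungDiagram}

theorem Strip.rowLen_succ_le (nu : Strip lam) (i : ℕ) : lam.rowLen (i + 1) ≤ nu.1.rowLen i :=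
  le_of_forall_lt fun j hj => YoungDiagram.mem_iff_lt_rowLen.1
    (nu.2.2 i j (YoungDiagram.mem_iff_lt_rowLen.2 hj))

theorem Strip.rowLen_le (nu : Strip lam) (i : ℕ) : nu.1.rowLen i ≤ lam.rowLen i :=
  rowLen_mono i nu.2.1

theorem Strip.rowLen_eq_zero (nu : Strip lam) {L : ℕ} (hL : lam.rowLen L = 0) :
    nu.1.rowLen L = 0 :=
  Nat.le_zero.1 (hL ▸ nu.rowLen_le L)

theorem Strip.ext_rowLen {L : ℕ} (hL : lam.rowLen L = 0) {nu nu' : Strip lam}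
    (h : ∀ i < L, nu.1.rowLen i = nu'.1.rowLen i) : nu = nu' := by
  refine Subtype.ext (youngDiagram_ext_rowLen fun i => ?_)
  by_cases hi : i < L
  · exact h i hi
  · rw [rowLen_eq_zero_of_le (nu.rowLen_eq_zero hL) (not_lt.1 hi),
      rowLen_eq_zero_of_le (nu'.rowLen_eq_zero hL) (not_lt.1 hi)]

theorem Strip.exists_rowLen_eq {L : ℕ} (hL : lam.rowLen L = 0) {t : Fin L → ℕ}
    (ht : ∀ i : Fin L, t i ∈ Finset.Icc (lam.rowLen (i + 1)) (lam.rowLen i)) :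
    ∃ nu : Strip lam, ∀ i : Fin L, nu.1.rowLen i = t i := by
  let b (i : ℕ) : ℕ := if h : i < L then t ⟨i, h⟩ else 0
  have hb (i : ℕ) : lam.rowLen (i + 1) ≤ b i ∧ b i ≤ lam.rowLen i := by
    by_cases h : i < L
    · rw [show b i = t ⟨i, h⟩ from dif_pos h]
      exact Finset.mem_Icc.1 (ht ⟨i, h⟩)
    · rw [show b i = 0 from dif_neg h, rowLen_eq_zero_of_le hL (by omega)]
      exact ⟨le_rfl, Nat.zero_le _⟩
  have hanti : Antitone b := antitone_nat_of_succ_le fun i => (hb (i + 1)).2.trans (hb i).1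
  have hrow := rowLen_diagramOfRows b hanti L (dif_neg (lt_irrefl L))
  refine ⟨⟨diagramOfRows b hanti L, ?_, fun i j h => ?_⟩, fun i => (hrow i).trans (dif_pos i.2)⟩
  · rintro ⟨i, j⟩ h
    change (i, j) ∈ diagramOfRows b hanti L at h
    rw [YoungDiagram.mem_iff_lt_rowLen, hrow] at h
    exact YoungDiagram.mem_iff_lt_rowLen.2 (h.trans_le (hb i).2)
  · rw [YoungDiagram.mem_iff_lt_rowLen] at h
    rw [YoungDiagram.mem_iff_lt_rowLen, hrow]
    exact h.trans_le (hb i).1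

theorem Strip.card_sub_card (nu : Strip lam) {L : ℕ} (hL : lam.rowLen L = 0) :
    lam.card - nu.1.card = ∑ i : Fin L, (lam.rowLen i - nu.1.rowLen i) := by
  rw [card_eq_sum_rowLen hL, card_eq_sum_rowLen (nu.rowLen_eq_zero hL),
    ← Finset.sum_range fun i => lam.rowLen i - nu.1.rowLen i,
    Finset.sum_tsub_distrib _ fun i _ => nu.rowLen_le i]

theorem forall_rowLen_eq_zero_iff_card_eq_zero {L : ℕ} (hL : lam.rowLen L = 0) :
    (∀ i < L, lam.rowLen i = 0) ↔ lam.card = 0 := by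
  rw [card_eq_sum_rowLen hL, Finset.sum_eq_zero_iff]
  simp only [Finset.mem_range]

theorem schurPoly_eq_jacobiTrudi (R : Type*) [CommRing R] (k : ℕ) {L : ℕ} (lam : YoungDiagram)
    (hL : lam.rowLen L = 0) :
    schurPoly R k lam = jacobiTrudi R k fun i : Fin L => lam.rowLen i := by
  have hanti : Antitone lam.rowLen := fun i j h => lam.rowLen_anti i j h
  induction k generalizing lam with
  | zero =>
    rw [schurPoly_zero, jacobiTrudi_zero R hanti]
    exact if_congr (forall_rowLen_eq_zero_iff_card_eq_zero hL).symm rfl rfl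
  | succ k ih =>
    have := Fintype.ofFinite (Strip lam)
    rw [schurPoly_succ, jacobiTrudi_succ k L hanti hL]
    refine Finset.sum_bij (fun nu _ i => nu.1.rowLen i) (fun nu _ => ?_) (fun nu _ nu' _ h => ?_)
      (fun t ht => ?_) fun nu _ => ?_
    · exact Fintype.mem_piFinset.2 fun i =>
        Finset.mem_Icc.2 ⟨nu.rowLen_succ_le i, nu.rowLen_le i⟩
    · exact Strip.ext_rowLen hL fun i hi => congrFun h ⟨i, hi⟩
    · obtain ⟨nu, hnu⟩ := Strip.exists_rowLen_eq hL (Fintype.mem_piFinset.1 ht)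
      exact ⟨nu, Finset.mem_univ _, funext hnu⟩
    · rw [nu.card_sub_card hL,
        ih nu.1 (nu.rowLen_eq_zero hL) fun i j h => nu.1.rowLen_anti i j h]

/-- Matrices of natural numbers with row sums `a` and column sums `m`. -/
abbrev Contingency {l : ℕ} (a : Fin l → ℤ) (m : ℕ →₀ ℕ) : Type :=
  {M : Fin l → ℕ →₀ ℕ // (∀ i, ((M i).degree : ℤ) = a i) ∧ ∑ i, M i = m}

theorem coeff_prod_hPoly (R : Type*) [CommSemiring R] {k l : ℕ} (a : Fin l → ℤ) {m : ℕ →₀ ℕ}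
    (hm : ∀ j, k ≤ j → m j = 0) :
    MvPowerSeries.coeff m (∏ i, hPoly R k (a i)) = (Nat.card (Contingency a m) : R) := by
  simp only [hPoly]
  rw [prod_weightSeries R fun i => finiteFibres_of_injective Subtype.val_injective,
    coeff_weightSeries]
  refine congrArg _ (Nat.card_congr
    { toFun := fun M => ⟨fun i => (M.1 i).1, fun i => (M.1 i).2.2, M.2⟩
      invFun := fun M => ⟨fun i => ⟨M.1 i, fun j hj => ?_, M.2.1 i⟩, M.2.2⟩
      left_inv := fun _ => rfl
      right_inv := fun _ => rfl })
  have hcol := DFunLike.congr_fun M.2.2 j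
  rw [hm j hj, Finsupp.finsetSum_apply, Finset.sum_eq_zero_iff] at hcol
  exact hcol i (Finset.mem_univ i)

theorem exists_forall_le_apply_eq_zero (m : ℕ →₀ ℕ) : ∃ k, ∀ j, k ≤ j → m j = 0 := by
  obtain ⟨k, hk⟩ := m.support.exists_nat_subset_range
  refine ⟨k, fun j hj => Finsupp.notMem_support_iff.1 fun h => ?_⟩
  exact hj.not_gt (Finset.mem_range.1 (hk h))

theorem coeff_schur (lam : YoungDiagram) (m : ℕ →₀ ℕ) :
    MvPowerSeries.coeff m (schur lam) = ∑ s : Equiv.Perm (Fin (lam.colLen 0)),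
      (Equiv.Perm.sign s : ℤ) * (Nat.card (Contingency (shiftedParts lam s) m) : ℤ) := by
  obtain ⟨k, hk⟩ := exists_forall_le_apply_eq_zero m
  rw [← coeff_schurPoly hk, schurPoly_eq_jacobiTrudi ℤ k lam (rowLen_colLen lam), jacobiTrudi,
    ← Matrix.det_transpose, Matrix.det_apply, map_sum]
  refine Finset.sum_congr rfl fun s _ => ?_
  rw [Units.smul_def, map_zsmul, smul_eq_mul, ← coeff_prod_hPoly ℤ _ hk]
  simp only [Matrix.transpose_apply, Matrix.of_apply, shiftedParts, add_sub, sub_add_eq_add_sub]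

end JacobiTrudi

/-! ### The Frobenius character formula -/

section PowerSums

variable {X : Type*} [Fintype X] {σ : Type*}

theorem exists_perm_comp_eq {f f' : X → σ} (h : content f = content f') :
    ∃ g : Equiv.Perm X, f' ∘ g = f := by
  have e (y : σ) : {x // f x = y} ≃ {x // f' x = y} :=
    (Finite.card_eq.1 (by rw [← content_apply, ← content_apply, h])).some
  refine ⟨((Equiv.sigmaFiberEquiv f).symm.trans (Equiv.sigmaCongrRight e)).trans
    (Equiv.sigmaFiberEquiv f'), funext fun x => ?_⟩
  exact (e (f x) ⟨x, rfl⟩).2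

theorem exists_content_eq {m : σ →₀ ℕ} (hm : m.degree = Fintype.card X) :
    ∃ f : X → σ, content f = m := by
  have hcard : Fintype.card X = Fintype.card (Σ j : m.support, Fin (m j)) := by
    simp only [Fintype.card_sigma, Fintype.card_fin]
    rw [← hm, Finsupp.degree_apply]
    exact (Finset.sum_coe_sort m.support m).symm
  refine ⟨(fun y => (y.1 : σ)) ∘ Fintype.equivOfCardEq hcard, ?_⟩
  rw [content_comp_equiv, content, Fintype.sum_sigma]
  simp only [Finset.sum_const, Finset.card_univ, Fintype.card_fin, Finsupp.smul_single,
    smul_eq_mul, mul_one]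
  exact (Finset.sum_coe_sort m.support fun j => Finsupp.single j (m j)).trans m.sum_single

/-- Permutations of `X` act on the maps from `X` of a given content, by `g • f = f ∘ g⁻¹`. -/
instance contentAction (m : σ →₀ ℕ) :
    MulAction (Equiv.Perm X) {f : X → σ // content f = m} where
  smul g f := ⟨f.1 ∘ g.symm, (content_comp_equiv f.1 g.symm).trans f.2⟩
  one_smul _ := rfl
  mul_smul _ _ _ := rfl

theorem smul_eq_self_iff_forall_apply_eq {m : σ →₀ ℕ} (g : Equiv.Perm X)
    (f : {f : X → σ // content f = m}) : g • f = f ↔ ∀ x, f.1 (g x) = f.1 x := by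
  rw [Subtype.ext_iff, eq_comm]
  exact (Equiv.eq_comp_symm g f.1 f.1).trans funext_iff

instance (m : σ →₀ ℕ) : MulAction.IsPretransitive (Equiv.Perm X) {f : X → σ // content f = m} where
  exists_smul_eq f f' := by
    obtain ⟨g, hg⟩ := exists_perm_comp_eq (f.2.trans f'.2.symm)
    exact ⟨g, Subtype.ext ((Equiv.comp_symm_eq g f'.1 f.1).2 hg.symm)⟩

-- Burnside's lemma for a transitive action.
theorem sum_card_fixed_content [DecidableEq X] {m : σ →₀ ℕ} (hm : m.degree = Fintype.card X) :
    ∑ g : Equiv.Perm X, Nat.card {f : X → σ // (∀ x, f (g x) = f x) ∧ content f = m} =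
      (Fintype.card X).factorial := by
  have := finiteFibres_content (X := X) m
  have hfixed (g : Equiv.Perm X) :
      Nat.card {f : X → σ // (∀ x, f (g x) = f x) ∧ content f = m} =
        Nat.card (MulAction.fixedBy {f : X → σ // content f = m} g) := by
    refine Nat.card_congr (((Equiv.subtypeEquivRight fun f => and_comm).trans
      (Equiv.subtypeSubtypeEquivSubtypeInter _ _).symm).trans (Equiv.subtypeEquivRight fun f => ?_))
    exact (smul_eq_self_iff_forall_apply_eq g f).symm
  obtain ⟨f, hf⟩ := exists_content_eq hm
  have : Nonempty {f : X → σ // content f = m} := ⟨⟨f, hf⟩⟩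
  obtain ⟨_⟩ := (MulAction.pretransitive_iff_unique_quotient_of_nonempty (Equiv.Perm X)
    {f : X → σ // content f = m}).1 inferInstance
  simp only [hfixed]
  rw [← Nat.card_sigma, Nat.card_congr (MulAction.sigmaFixedByEquivOrbitsProdGroup _ _),
    Nat.card_prod, Nat.card_unique, one_mul, Nat.card_perm, Nat.card_eq_fintype_card]

theorem curry_content_apply {ι : Type*} [DecidableEq ι] (F : X → ι × σ) (i : ι) :
    (content F).curry i = ∑ x, if (F x).1 = i then Finsupp.single (F x).2 1 else 0 := by
  rw [content, ← Finsupp.coe_curryAddEquiv, map_sum, Finsupp.finsetSum_apply]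
  simp only [Finsupp.coe_curryAddEquiv, Finsupp.curry_single, Finsupp.single_apply]

theorem degree_curry_content {ι : Type*} (F : X → ι × σ) (i : ι) :
    ((content F).curry i).degree = Nat.card {x // (F x).1 = i} := by
  classical
  rw [curry_content_apply, map_sum, Nat.card_eq_fintype_card, Fintype.card_subtype,
    Finset.card_filter]
  refine Finset.sum_congr rfl fun x _ => ?_
  rw [apply_ite Finsupp.degree, Finsupp.degree_single, map_zero]

theorem sum_curry_content {ι : Type*} [Fintype ι] (F : X → ι × σ) :
    ∑ i, (content F).curry i = content fun x => (F x).2 := by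
  classical
  simp only [curry_content_apply]
  rw [Finset.sum_comm, content]
  simp only [Finset.sum_ite_eq, Finset.mem_univ, if_true]

theorem degree_uncurry {ι : Type*} (M : ι →₀ σ →₀ ℕ) :
    M.uncurry.degree = M.sum fun _ m => m.degree :=
  Finsupp.sum_uncurry_index M fun _ n => n

theorem finite_contingency {l : ℕ} (a : Fin l → ℤ) (m : ℕ →₀ ℕ) : Finite (Contingency a m) := by
  refine Set.Finite.subset (Set.finite_Iic fun _ => m) fun M hM i => ?_
  rw [← hM.2]
  exact Finset.single_le_sum (fun _ _ => zero_le) (Finset.mem_univ i)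

/-- A pair of maps with given contents which are constant on the cycles of `g` is a map to a
product, and the content of the latter is a contingency table. -/
def fixedPairsEquiv {l : ℕ} (a : Fin l → ℤ) (m : ℕ →₀ ℕ) (g : Equiv.Perm X) :
    {f : X → Fin l // (∀ x, f (g x) = f x) ∧ ∀ j, (Nat.card {x : X // f x = j} : ℤ) = a j} ×
      {f : X → ℕ // (∀ x, f (g x) = f x) ∧ content f = m} ≃
    Σ M : Contingency a m, {F : X → Fin l × ℕ // (∀ x, F (g x) = F x) ∧
      content F = (Finsupp.equivFunOnFinite.symm M.1).uncurry} where
  toFun p :=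
    let F : X → Fin l × ℕ := fun x => (p.1.1 x, p.2.1 x)
    ⟨⟨(content F).curry, fun i => by rw [degree_curry_content, p.1.2.2],
      by rw [sum_curry_content, p.2.2.2]⟩, F, fun x => Prod.ext (p.1.2.1 x) (p.2.2.1 x), by simp⟩
  invFun q :=
    have hcurry : (content q.2.1).curry = Finsupp.equivFunOnFinite.symm q.1.1 := by
      rw [q.2.2.2, Finsupp.curry_uncurry]
    ⟨⟨fun x => (q.2.1 x).1, fun x => congrArg Prod.fst (q.2.2.1 x), fun i => by
        rw [← degree_curry_content, hcurry]; exact q.1.2.1 i⟩,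
      ⟨fun x => (q.2.1 x).2, fun x => congrArg Prod.snd (q.2.2.1 x), by
        rw [← sum_curry_content, hcurry]; exact q.1.2.2⟩⟩
  left_inv _ := rfl
  right_inv := by
    rintro ⟨⟨M, hM⟩, F, hg, hF⟩
    obtain rfl : M = (content F).curry := by rw [hF, Finsupp.curry_uncurry]; rfl
    rfl

theorem sum_card_fixedPairs [DecidableEq X] {l : ℕ} (a : Fin l → ℤ) (m : ℕ →₀ ℕ)
    (ha : ∑ i, a i = Fintype.card X) :
    ∑ g : Equiv.Perm X, Nat.card (
      {f : X → Fin l // (∀ x, f (g x) = f x) ∧ ∀ j, (Nat.card {x : X // f x = j} : ℤ) = a j} ×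
        {f : X → ℕ // (∀ x, f (g x) = f x) ∧ content f = m}) =
      (Fintype.card X).factorial * Nat.card (Contingency a m) := by
  have := finite_contingency a m
  have := Fintype.ofFinite (Contingency a m)
  have hdeg (M : Contingency a m) :
      (Finsupp.equivFunOnFinite.symm M.1).uncurry.degree = Fintype.card X := by
    rw [degree_uncurry, Finsupp.sum_fintype _ _ fun _ => map_zero _, ← Nat.cast_inj (R := ℤ), ← ha,
      Nat.cast_sum]
    exact Finset.sum_congr rfl fun i _ => M.2.1 i
  have (g : Equiv.Perm X) (M : Contingency a m) : Finite {F : X → Fin l × ℕ //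
      (∀ x, F (g x) = F x) ∧ content F = (Finsupp.equivFunOnFinite.symm M.1).uncurry} :=
    Set.Finite.subset (finiteFibres_content (X := X) _) fun _ h => h.2
  simp only [Nat.card_congr (fixedPairsEquiv a m _), Nat.card_sigma]
  rw [Finset.sum_comm, Finset.sum_congr rfl fun M _ => sum_card_fixed_content (hdeg M),
    Finset.sum_const, Finset.card_univ, smul_eq_mul, mul_comm, Nat.card_eq_fintype_card]

theorem sum_shiftedParts (lam : YoungDiagram) (s : Equiv.Perm (Fin (lam.colLen 0))) :
    ∑ i, shiftedParts lam s i = lam.card := by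
  simp only [shiftedParts]
  rw [Finset.sum_add_distrib, Finset.sum_sub_distrib,
    Equiv.sum_comp s fun i : Fin (lam.colLen 0) => ((i : ℕ) : ℤ), sub_add_cancel,
    card_eq_sum_rowLen (rowLen_colLen lam), Finset.sum_range]
  push_cast
  rfl

theorem factorial_smul_schur [DecidableEq X] (lam : YoungDiagram)
    (hX : Fintype.card X = lam.card) :
    (lam.card.factorial : ℤ) • schur lam = ∑ g : Equiv.Perm X, chi lam g • fixSeries g := by
  ext m
  have hcount (s : Equiv.Perm (Fin (lam.colLen 0))) :
      ∑ g : Equiv.Perm X, youngPermChar (shiftedParts lam s) g *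
        MvPowerSeries.coeff m (fixSeries g) =
      lam.card.factorial * (Nat.card (Contingency (shiftedParts lam s) m) : ℤ) := by
    rw [← hX, ← Nat.cast_mul,
      ← sum_card_fixedPairs (X := X) _ m (by rw [sum_shiftedParts, hX]), Nat.cast_sum]
    refine Finset.sum_congr rfl fun g _ => ?_
    rw [Nat.card_prod, Nat.cast_mul, coeff_fixSeries, youngPermChar]
  rw [map_zsmul, smul_eq_mul, coeff_schur, Finset.mul_sum, map_sum]
  simp only [map_zsmul, smul_eq_mul, mul_left_comm (lam.card.factorial : ℤ), ← hcount,
    Finset.mul_sum, ← mul_assoc]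
  rw [Finset.sum_comm]
  simp only [← Finset.sum_mul]
  rfl

end PowerSums

/-! ### Duality of the Schur functions and the coordinates -/

section Dominance

/-- `f ⊴ g` in the dominance order on sequences: every partial sum of `f` is at most that of `g`. -/
def DominatedBy (f g : ℕ → ℕ) : Prop :=
  ∀ k, ∑ j ∈ Finset.range k, f j ≤ ∑ j ∈ Finset.range k, g j

theorem DominatedBy.trans {f g h : ℕ → ℕ} (hfg : DominatedBy f g) (hgh : DominatedBy g h) :
    DominatedBy f h := fun k => (hfg k).trans (hgh k)

theorem DominatedBy.antisymm {f g : ℕ → ℕ} (hfg : DominatedBy f g) (hgf : DominatedBy g f) :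
    f = g := by
  have hsum (k : ℕ) := (hfg k).antisymm (hgf k)
  funext j
  have hj := hsum (j + 1)
  rwa [Finset.sum_range_succ, Finset.sum_range_succ, hsum j, Nat.add_left_cancel_iff] at hj

end Dominance

section Triangularity

theorem sum_mul_rowLen_le (mu : YoungDiagram) (s : Equiv.Perm (Fin (mu.colLen 0)))
    {f : Fin (mu.colLen 0) → ℤ} (hf : Antitone f) :
    ∑ i, f i * mu.rowLen i ≤ ∑ i, f i * shiftedParts mu s i := by
  have hanti : Antivary f fun i : Fin (mu.colLen 0) => ((i : ℕ) : ℤ) := fun i j hij =>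
    hf (by simpa using hij.le)
  have hsplit : ∑ i, f i * shiftedParts mu s i = ∑ i, f i * mu.rowLen i +
      (∑ i, f i * ((s i : ℕ) : ℤ) - ∑ i, f i * ((i : ℕ) : ℤ)) := by
    rw [← Finset.sum_sub_distrib, ← Finset.sum_add_distrib]
    exact Finset.sum_congr rfl fun i _ => by rw [shiftedParts]; ring
  linarith [hanti.sum_mul_le_sum_mul_comp_perm (σ := s)]

theorem sum_sq_rowLen_lt (mu : YoungDiagram) {s : Equiv.Perm (Fin (mu.colLen 0))} (hs : s ≠ 1) :
    ∑ i : Fin (mu.colLen 0), (mu.rowLen i : ℤ) ^ 2 < ∑ i, shiftedParts mu s i ^ 2 := by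
  have hle := sum_mul_rowLen_le mu s (f := fun i => (mu.rowLen i : ℤ)) fun i j hij =>
    Int.ofNat_le.2 (mu.rowLen_anti i j hij)
  have hexpand : ∑ i, shiftedParts mu s i ^ 2 =
      2 * ∑ i : Fin (mu.colLen 0), mu.rowLen i * shiftedParts mu s i -
        ∑ i : Fin (mu.colLen 0), (mu.rowLen i : ℤ) ^ 2 + ∑ i, (((s i : ℕ) : ℤ) - (i : ℕ)) ^ 2 := by
    rw [Finset.mul_sum, ← Finset.sum_sub_distrib, ← Finset.sum_add_distrib]
    exact Finset.sum_congr rfl fun i _ => by rw [shiftedParts]; ring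
  have hpos : 0 < ∑ i, (((s i : ℕ) : ℤ) - (i : ℕ)) ^ 2 := by
    obtain ⟨i, hi⟩ := not_forall.1 fun h => hs (Equiv.ext h)
    refine Finset.sum_pos' (fun i _ => sq_nonneg _) ⟨i, Finset.mem_univ i, ?_⟩
    have : (s i : ℕ) ≠ i := fun h => hi (Fin.ext h)
    exact sq_pos_of_ne_zero (by omega)
  simp only [← sq] at hle
  linarith

/-- The exponent of the monomial `x^lam`. -/
def rowExponent (lam : YoungDiagram) : ℕ →₀ ℕ := natExponent (shiftedParts lam 1)

theorem shiftedParts_one (lam : YoungDiagram) (i : Fin (lam.colLen 0)) :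
    shiftedParts lam 1 i = lam.rowLen i := by
  simp [shiftedParts]

theorem coe_rowExponent (lam : YoungDiagram) : ⇑(rowExponent lam) = lam.rowLen := by
  funext j
  rcases lt_or_ge j (lam.colLen 0) with hj | hj
  · simpa only [rowExponent, shiftedParts_one, Int.toNat_natCast] using
      natExponent_apply (shiftedParts lam 1) ⟨j, hj⟩
  · rw [rowExponent, natExponent_apply_of_le _ hj, rowLen_eq_zero_of_le (rowLen_colLen lam) hj]

/-- The sum of the squares of the entries of an exponent. Among the exponents
`mu - δ + s(δ)`, it is smallest for `s = 1`, which makes it a measure for induction. -/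
def sqSum (m : ℕ →₀ ℕ) : ℕ := m.sum fun _ a => a ^ 2

theorem sqSum_equivMapDomain (m : ℕ →₀ ℕ) (τ : Equiv.Perm ℕ) :
    sqSum (m.equivMapDomain τ) = sqSum m := by
  rw [Finsupp.equivMapDomain_eq_mapDomain, sqSum, Finsupp.sum_mapDomain_index_inj τ.injective]
  rfl

theorem sqSum_le (m : ℕ →₀ ℕ) : sqSum m ≤ m.degree ^ 2 :=
  Finset.sum_sq_le_sq_sum_of_nonneg fun _ _ => Nat.zero_le _

theorem sqSum_natExponent {l : ℕ} {a : Fin l → ℤ} (ha : ∀ i, 0 ≤ a i) :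
    (sqSum (natExponent a) : ℤ) = ∑ i, a i ^ 2 := by
  have hrange : sqSum (natExponent a) = ∑ j ∈ Finset.range l, natExponent a j ^ 2 := by
    refine Finsupp.sum_of_support_subset _ (fun j hj => ?_) _ fun _ _ => by simp
    rw [Finset.mem_range]
    by_contra hl
    exact Finsupp.mem_support_iff.1 hj (natExponent_apply_of_le a (not_lt.1 hl))
  rw [hrange, Finset.sum_range]
  push_cast
  exact Finset.sum_congr rfl fun i _ => by rw [natExponent_apply, Int.toNat_of_nonneg (ha i)]

theorem sqSum_rowExponent_lt {mu : YoungDiagram} {s : Equiv.Perm (Fin (mu.colLen 0))}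
    (hs : s ≠ 1) (hnonneg : ∀ i, 0 ≤ shiftedParts mu s i) :
    sqSum (rowExponent mu) < sqSum (natExponent (shiftedParts mu s)) := by
  rw [← Nat.cast_lt (α := ℤ), rowExponent, sqSum_natExponent hnonneg,
    sqSum_natExponent fun i => by rw [shiftedParts_one]; omega]
  simpa only [shiftedParts_one] using sum_sq_rowLen_lt mu hs

theorem sum_range_eq_sum_fin {L : ℕ} {f : ℕ → ℕ} (hf : ∀ j, L ≤ j → f j = 0) (k : ℕ) :
    ∑ j ∈ Finset.range k, f j = ∑ i : Fin L, if (i : ℕ) < k then f i else 0 := by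
  rw [← Finset.sum_range fun i => if i < k then f i else 0, ← Finset.sum_filter]
  refine (Finset.sum_subset (fun j hj => ?_) fun j hj hj' => hf j ?_).symm
  · exact Finset.mem_range.2 (Finset.mem_filter.1 hj).2
  · by_contra h
    exact hj' (Finset.mem_filter.2 ⟨Finset.mem_range.2 (not_le.1 h), Finset.mem_range.1 hj⟩)

theorem rowLen_dominatedBy_natExponent {mu : YoungDiagram} {s : Equiv.Perm (Fin (mu.colLen 0))}
    (hs : ∀ i, 0 ≤ shiftedParts mu s i) :
    DominatedBy mu.rowLen (natExponent (shiftedParts mu s)) := fun k => by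
  have hle := sum_mul_rowLen_le mu s (f := fun i => if (i : ℕ) < k then 1 else 0)
    fun i j (hij : (i : ℕ) ≤ j) => by
      simp only
      split_ifs <;> omega
  rw [sum_range_eq_sum_fin (fun j hj => rowLen_eq_zero_of_le (rowLen_colLen mu) hj),
    sum_range_eq_sum_fin fun j hj => natExponent_apply_of_le (shiftedParts mu s) hj]
  rw [← Nat.cast_le (α := ℤ)]
  simpa only [Nat.cast_sum, natExponent_apply, Nat.cast_ite, Int.toNat_of_nonneg (hs _),
    Nat.cast_zero, ite_mul, one_mul, zero_mul] using hle

theorem degree_natExponent {l : ℕ} {a : Fin l → ℤ} (ha : ∀ i, 0 ≤ a i) :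
    ((natExponent a).degree : ℤ) = ∑ i, a i := by
  rw [natExponent, map_sum]
  push_cast
  exact Finset.sum_congr rfl fun i _ => by simp [ha i]

theorem nonneg_and_coeff_ne_zero_of_intCoeff_ne_zero {l : ℕ} {a : Fin l → ℤ}
    {F : MvPowerSeries ℕ ℤ} (h : intCoeff a F ≠ 0) :
    (∀ i, 0 ≤ a i) ∧ MvPowerSeries.coeff (natExponent a) F ≠ 0 := by
  have ha (i) : 0 ≤ a i := not_lt.1 fun hi => h (intCoeff_of_neg hi F)
  exact ⟨ha, by rwa [intCoeff_of_nonneg ha] at h⟩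

theorem exists_dominating_of_schurCoord_ne_zero {mu : YoungDiagram} {F : MvPowerSeries ℕ ℤ}
    (h : schurCoord mu F ≠ 0) : ∃ m : ℕ →₀ ℕ, MvPowerSeries.coeff m F ≠ 0 ∧ m.degree = mu.card ∧
      DominatedBy mu.rowLen m := by
  rw [schurCoord_apply] at h
  obtain ⟨s, -, hs⟩ := Finset.exists_ne_zero_of_sum_ne_zero h
  obtain ⟨hnonneg, hcoeff⟩ :=
    nonneg_and_coeff_ne_zero_of_intCoeff_ne_zero (right_ne_zero_of_mul hs)
  refine ⟨_, hcoeff, ?_, rowLen_dominatedBy_natExponent hnonneg⟩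
  exact_mod_cast (degree_natExponent hnonneg).trans (sum_shiftedParts mu s)

variable {lam : YoungDiagram}

theorem le_tableau_apply (T : SemistandardYoungTableau lam) {i j : ℕ} (h : (i, j) ∈ lam) :
    i ≤ T i j := by
  induction i with
  | zero => exact Nat.zero_le _
  | succ i ih =>
    have hi := ih (lam.up_left_mem (Nat.le_succ i) le_rfl h)
    exact Nat.succ_le_of_lt (hi.trans_lt (T.col_strict (Nat.lt_succ_self i) h))

theorem sum_range_tableauWeight (T : SemistandardYoungTableau lam) (k : ℕ) :
    ∑ j ∈ Finset.range k, tableauWeight T j =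
      (lam.cells.filter fun c => T c.1 c.2 < k).card := by
  simp only [card_filter_lt_eq_sum, tableauWeight_apply]

theorem filter_tableau_lt_subset (T : SemistandardYoungTableau lam) (k : ℕ) :
    (lam.cells.filter fun c => T c.1 c.2 < k) ⊆ lam.cells.filter fun c => c.1 < k := fun c hc => by
  rw [Finset.mem_filter] at hc ⊢
  exact ⟨hc.1, (le_tableau_apply T ((YoungDiagram.mem_cells _).1 hc.1)).trans_lt hc.2⟩

theorem tableauWeight_dominatedBy_rowLen (T : SemistandardYoungTableau lam) :
    DominatedBy (tableauWeight T) lam.rowLen := fun k => by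
  rw [sum_range_tableauWeight, ← card_filter_row_lt]
  exact Finset.card_le_card (filter_tableau_lt_subset T k)

theorem exists_tableau_of_coeff_schur_ne_zero {m : ℕ →₀ ℕ}
    (h : MvPowerSeries.coeff m (schur lam) ≠ 0) :
    ∃ T : SemistandardYoungTableau lam, tableauWeight T = m := by
  by_contra! hn
  have : IsEmpty {T : SemistandardYoungTableau lam // tableauWeight T = m} :=
    Subtype.isEmpty_of_false hn
  rw [schur_eq_weightSeries, coeff_weightSeries, Nat.card_of_isEmpty] at h
  exact h Nat.cast_zero

theorem degree_eq_of_coeff_schur_ne_zero {m : ℕ →₀ ℕ}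
    (h : MvPowerSeries.coeff m (schur lam) ≠ 0) : m.degree = lam.card := by
  obtain ⟨T, rfl⟩ := exists_tableau_of_coeff_schur_ne_zero h
  exact degree_tableauWeight T

theorem dominatedBy_rowLen_of_coeff_schur_ne_zero {m : ℕ →₀ ℕ}
    (h : MvPowerSeries.coeff m (schur lam) ≠ 0) : DominatedBy m lam.rowLen := by
  obtain ⟨T, rfl⟩ := exists_tableau_of_coeff_schur_ne_zero h
  exact tableauWeight_dominatedBy_rowLen T

theorem tableauWeight_highestWeight (lam : YoungDiagram) :
    tableauWeight (SemistandardYoungTableau.highestWeight lam) = rowExponent lam := by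
  ext k
  rw [tableauWeight_apply, coe_rowExponent, YoungDiagram.rowLen_eq_card, YoungDiagram.row]
  congr 1
  refine Finset.filter_congr fun c hc => ?_
  rw [SemistandardYoungTableau.highestWeight_apply, if_pos ((YoungDiagram.mem_cells _).1 hc)]

theorem eq_highestWeight_of_tableauWeight_eq {T : SemistandardYoungTableau lam}
    (hT : tableauWeight T = rowExponent lam) : T = SemistandardYoungTableau.highestWeight lam := by
  have hfilter (k : ℕ) : (lam.cells.filter fun c => T c.1 c.2 < k) =
      lam.cells.filter fun c => c.1 < k := by
    refine Finset.eq_of_subset_of_card_le (filter_tableau_lt_subset T k) ?_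
    rw [← sum_range_tableauWeight, card_filter_row_lt, hT, coe_rowExponent]
  refine tableau_ext_of_mem fun i j h => ?_
  have hlt : (i, j) ∈ lam.cells.filter fun c => T c.1 c.2 < i + 1 := by
    rw [hfilter, Finset.mem_filter]
    exact ⟨(YoungDiagram.mem_cells _).2 h, Nat.lt_succ_self i⟩
  rw [SemistandardYoungTableau.highestWeight_apply, if_pos h]
  exact (Nat.le_of_lt_succ (Finset.mem_filter.1 hlt).2).antisymm (le_tableau_apply T h)

theorem coeff_rowExponent_schur (lam : YoungDiagram) :
    MvPowerSeries.coeff (rowExponent lam) (schur lam) = 1 := by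
  rw [schur_eq_weightSeries, coeff_weightSeries]
  have : Unique {T : SemistandardYoungTableau lam // tableauWeight T = rowExponent lam} :=
    ⟨⟨⟨_, tableauWeight_highestWeight lam⟩⟩,
      fun T => Subtype.ext (eq_highestWeight_of_tableauWeight_eq T.2)⟩
  rw [Nat.card_unique, Nat.cast_one]

theorem schurCoord_eq_coeff_rowExponent {mu : YoungDiagram} {F : MvPowerSeries ℕ ℤ}
    (h : ∀ s ≠ 1, (∀ i, 0 ≤ shiftedParts mu s i) →
      MvPowerSeries.coeff (natExponent (shiftedParts mu s)) F = 0) :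
    schurCoord mu F = MvPowerSeries.coeff (rowExponent mu) F := by
  rw [schurCoord_apply, Finset.sum_eq_single 1 (fun s _ hs => ?_) (by simp)]
  · rw [intCoeff_of_nonneg fun i => by rw [shiftedParts_one]; omega]
    simp [rowExponent]
  · refine mul_eq_zero_of_right _ (not_not.1 fun hne => ?_)
    obtain ⟨hnonneg, hcoeff⟩ := nonneg_and_coeff_ne_zero_of_intCoeff_ne_zero hne
    exact hcoeff (h s hs hnonneg)

theorem schurCoord_schur_self (lam : YoungDiagram) : schurCoord lam (schur lam) = 1 := by
  rw [schurCoord_eq_coeff_rowExponent fun s hs hnonneg => ?_, coeff_rowExponent_schur]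
  by_contra hcoeff
  have hrow : rowExponent lam = natExponent (shiftedParts lam s) :=
    DFunLike.coe_injective <| (coe_rowExponent lam).trans <|
      (rowLen_dominatedBy_natExponent hnonneg).antisymm
        (dominatedBy_rowLen_of_coeff_schur_ne_zero hcoeff)
  exact (sqSum_rowExponent_lt hs hnonneg).ne (congrArg sqSum hrow)

theorem factorial_mul_schurCoord_schur (lam mu : YoungDiagram) :
    (lam.card.factorial : ℤ) * schurCoord mu (schur lam) =
      ∑ g : Equiv.Perm (Fin lam.card), chi lam g * chi mu g := by
  rw [← smul_eq_mul, ← map_zsmul,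
    factorial_smul_schur (X := Fin lam.card) lam (Fintype.card_fin _), map_sum]
  exact Finset.sum_congr rfl fun g _ => by rw [map_zsmul, smul_eq_mul, ← chi_eq_schurCoord]

theorem schurCoord_schur_comm {lam mu : YoungDiagram} (h : lam.card = mu.card) :
    schurCoord mu (schur lam) = schurCoord lam (schur mu) := by
  have hmu := factorial_mul_schurCoord_schur mu lam
  rw [← h] at hmu
  refine mul_left_cancel₀ (Nat.cast_ne_zero.2 lam.card.factorial_ne_zero : (_ : ℤ) ≠ 0) ?_
  rw [factorial_mul_schurCoord_schur, hmu]
  exact Finset.sum_congr rfl fun g _ => mul_comm _ _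

theorem card_eq_and_rowLen_dominatedBy_of_schurCoord_schur_ne_zero {lam mu : YoungDiagram}
    (h : schurCoord mu (schur lam) ≠ 0) :
    lam.card = mu.card ∧ DominatedBy mu.rowLen lam.rowLen := by
  obtain ⟨m, hcoeff, hdeg, hdom⟩ := exists_dominating_of_schurCoord_ne_zero h
  exact ⟨(degree_eq_of_coeff_schur_ne_zero hcoeff).symm.trans hdeg,
    hdom.trans (dominatedBy_rowLen_of_coeff_schur_ne_zero hcoeff)⟩

-- The pairing is symmetric and triangular for the dominance order, hence diagonal.
theorem schurCoord_schur_of_ne {lam mu : YoungDiagram} (hne : lam ≠ mu) :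
    schurCoord mu (schur lam) = 0 := by
  by_contra h
  obtain ⟨hcard, hdom⟩ := card_eq_and_rowLen_dominatedBy_of_schurCoord_schur_ne_zero h
  rw [schurCoord_schur_comm hcard] at h
  have hdom' := (card_eq_and_rowLen_dominatedBy_of_schurCoord_schur_ne_zero h).2
  exact hne (youngDiagram_ext_rowLen (congrFun (hdom'.antisymm hdom)))

theorem schurCoord_finsuppSum (c : YoungDiagram →₀ ℤ) (mu : YoungDiagram) :
    schurCoord mu (c.sum fun nu a => a • schur nu) = c mu := by
  rw [Finsupp.sum, map_sum, Finset.sum_eq_single mu]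
  · rw [map_zsmul, schurCoord_schur_self, smul_eq_mul, mul_one]
  · intro nu _ hnu
    rw [map_zsmul, schurCoord_schur_of_ne hnu, smul_zero]
  · intro hmu
    rw [Finsupp.notMem_support_iff.1 hmu, zero_smul, map_zero]

end Triangularity

/-! ### Schur expansion of symmetric functions -/

section Expansion

/-- The group `Λⁿ` of homogeneous symmetric functions of degree `n`: the power series whose
coefficients are invariant under permutations of the variables and vanish outside degree `n`. -/
def symmFunctions (n : ℕ) : Submodule ℤ (MvPowerSeries ℕ ℤ) where
  carrier := {F |
    (∀ (τ : Equiv.Perm ℕ) (m : ℕ →₀ ℕ),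
      MvPowerSeries.coeff (m.equivMapDomain τ) F = MvPowerSeries.coeff m F) ∧
    ∀ m : ℕ →₀ ℕ, m.degree ≠ n → MvPowerSeries.coeff m F = 0}
  zero_mem' := ⟨fun _ _ => by simp only [map_zero], fun _ _ => map_zero _⟩
  add_mem' := fun hF hG =>
    ⟨fun τ m => by rw [map_add, map_add, hF.1, hG.1],
      fun m hm => by rw [map_add, hF.2 m hm, hG.2 m hm, add_zero]⟩
  smul_mem' := fun a F hF =>
    ⟨fun τ m => by rw [map_smul, map_smul, hF.1],
      fun m hm => by rw [map_smul, hF.2 m hm, smul_zero]⟩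

theorem degree_eq_of_mem_symmFunctions {n : ℕ} {F : MvPowerSeries ℕ ℤ} (hF : F ∈ symmFunctions n)
    {m : ℕ →₀ ℕ} (hm : MvPowerSeries.coeff m F ≠ 0) : m.degree = n :=
  not_imp_comm.1 (hF.2 m) hm

theorem mem_symmFunctions_of_zsmul_mem {n : ℕ} {a : ℤ} (ha : a ≠ 0) {F : MvPowerSeries ℕ ℤ}
    (h : a • F ∈ symmFunctions n) : F ∈ symmFunctions n := by
  refine ⟨fun τ m => ?_, fun m hm => ?_⟩
  · simpa only [map_zsmul, smul_eq_mul, mul_right_inj' ha] using h.1 τ m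
  · simpa only [map_zsmul, smul_eq_mul, mul_eq_zero, ha, false_or] using h.2 m hm

theorem fixSeries_mem_symmFunctions {X : Type*} [Fintype X] (g : Equiv.Perm X) :
    fixSeries g ∈ symmFunctions (Fintype.card X) := by
  refine ⟨fun τ m => ?_, fun m hm => ?_⟩
  · rw [coeff_fixSeries, coeff_fixSeries]
    refine congrArg _ (Nat.card_congr ((Equiv.arrowCongr (Equiv.refl X) τ).subtypeEquiv
      fun f => and_congr ?_ ?_)).symm
    · exact forall_congr' fun x => τ.apply_eq_iff_eq.symm
    · change content f = m ↔ content (τ ∘ f) = m.equivMapDomain τ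
      rw [content_comp_left_equiv]
      exact (Finsupp.equivCongrLeft τ).apply_eq_iff_eq.symm
  · rw [coeff_fixSeries]
    have : IsEmpty {f : X → ℕ // (∀ x, f (g x) = f x) ∧ content f = m} :=
      ⟨fun f => hm (f.2.2 ▸ degree_content f.1)⟩
    rw [Nat.card_of_isEmpty, Nat.cast_zero]

theorem schur_mem_symmFunctions (lam : YoungDiagram) : schur lam ∈ symmFunctions lam.card := by
  refine mem_symmFunctions_of_zsmul_mem (Nat.cast_ne_zero.2 lam.card.factorial_ne_zero) ?_
  rw [factorial_smul_schur (X := Fin lam.card) lam (Fintype.card_fin _)]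
  refine Submodule.sum_mem _ fun g _ => Submodule.smul_mem _ _ ?_
  simpa only [Fintype.card_fin] using fixSeries_mem_symmFunctions g

theorem exists_antitone_comp_perm (m : ℕ →₀ ℕ) : ∃ τ : Equiv.Perm ℕ, Antitone (m ∘ τ) := by
  obtain ⟨L, hL⟩ := exists_forall_le_apply_eq_zero m
  let f : Fin L → ℕᵒᵈ := fun i => OrderDual.toDual (m i)
  let τ : Equiv.Perm ℕ := (Tuple.sort f).extendDomain Fin.equivSubtype
  have hτ_lt (j : ℕ) (hj : j < L) : τ j = Tuple.sort f ⟨j, hj⟩ :=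
    (Equiv.Perm.extendDomain_apply_subtype _ _ (p := (· < L)) hj).trans rfl
  have hτ_ge (j : ℕ) (hj : L ≤ j) : τ j = j :=
    Equiv.Perm.extendDomain_apply_not_subtype _ _ (not_lt.2 hj)
  refine ⟨τ, fun i j hij => ?_⟩
  rcases lt_or_ge j L with hj | hj
  · simp only [Function.comp_apply, hτ_lt i (hij.trans_lt hj), hτ_lt j hj]
    exact Tuple.monotone_sort f (show (⟨i, hij.trans_lt hj⟩ : Fin L) ≤ ⟨j, hj⟩ from hij)
  · simp only [Function.comp_apply, hτ_ge j hj, hL j hj, Nat.zero_le]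

theorem exists_rowExponent_eq (m : ℕ →₀ ℕ) :
    ∃ (mu : YoungDiagram) (τ : Equiv.Perm ℕ), m.equivMapDomain τ = rowExponent mu := by
  obtain ⟨τ, hτ⟩ := exists_antitone_comp_perm m
  obtain ⟨L, hL⟩ := exists_forall_le_apply_eq_zero (m.equivMapDomain τ.symm)
  refine ⟨diagramOfRows _ hτ L, τ.symm, Finsupp.ext fun j => ?_⟩
  rw [coe_rowExponent, rowLen_diagramOfRows _ hτ L (hL L le_rfl)]
  rfl

theorem eq_zero_of_schurCoord_eq_zero {n : ℕ} {F : MvPowerSeries ℕ ℤ} (hF : F ∈ symmFunctions n)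
    (h0 : ∀ mu, schurCoord mu F = 0) : F = 0 := by
  have hcoeff (d : ℕ) : ∀ m, n ^ 2 - sqSum m = d → MvPowerSeries.coeff m F = 0 := by
    induction d using Nat.strong_induction_on with
    | _ d ih =>
    intro m hd
    obtain ⟨mu, τ, hmu⟩ := exists_rowExponent_eq m
    rw [← hF.1 τ m, hmu, ← schurCoord_eq_coeff_rowExponent, h0]
    intro s hs hnonneg
    by_contra hne
    have hlt := sqSum_rowExponent_lt hs hnonneg
    rw [← hmu, sqSum_equivMapDomain] at hlt
    have hle := sqSum_le (natExponent (shiftedParts mu s))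
    rw [degree_eq_of_mem_symmFunctions hF hne] at hle
    exact hne (ih _ (by omega) _ rfl)
  ext m
  rw [hcoeff _ m rfl, map_zero]

theorem cells_subset_range_product (mu : YoungDiagram) :
    mu.cells ⊆ Finset.range mu.card ×ˢ Finset.range mu.card := by
  rintro ⟨i, j⟩ h
  rw [YoungDiagram.mem_cells] at h
  have hi : i < mu.colLen 0 :=
    YoungDiagram.mem_iff_lt_colLen.1 (mu.up_left_mem le_rfl (Nat.zero_le j) h)
  have hj : j < mu.rowLen 0 :=
    YoungDiagram.mem_iff_lt_rowLen.1 (mu.up_left_mem (Nat.zero_le i) le_rfl h)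
  rw [YoungDiagram.colLen_eq_card] at hi
  rw [YoungDiagram.rowLen_eq_card] at hj
  rw [Finset.mem_product, Finset.mem_range, Finset.mem_range]
  exact ⟨hi.trans_le (Finset.card_le_card (Finset.filter_subset _ _)),
    hj.trans_le (Finset.card_le_card (Finset.filter_subset _ _))⟩

theorem finite_card_eq (n : ℕ) : {mu : YoungDiagram | mu.card = n}.Finite := by
  refine Set.Finite.of_finite_image (f := YoungDiagram.cells)
    ((Finset.finite_toSet (Finset.range n ×ˢ Finset.range n).powerset).subset ?_)
    fun mu _ nu _ h => YoungDiagram.ext h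
  rintro _ ⟨mu, rfl, rfl⟩
  exact Finset.mem_coe.2 (Finset.mem_powerset.2 (cells_subset_range_product mu))

theorem card_eq_of_schurCoord_ne_zero {n : ℕ} {F : MvPowerSeries ℕ ℤ} (hF : F ∈ symmFunctions n)
    {mu : YoungDiagram} (h : schurCoord mu F ≠ 0) : mu.card = n := by
  obtain ⟨m, hcoeff, hdeg, -⟩ := exists_dominating_of_schurCoord_ne_zero h
  exact hdeg.symm.trans (degree_eq_of_mem_symmFunctions hF hcoeff)

/-- The family of the coordinates of a homogeneous symmetric function in the Schur functions. -/
def schurCoords {n : ℕ} {F : MvPowerSeries ℕ ℤ} (hF : F ∈ symmFunctions n) : YoungDiagram →₀ ℤ :=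
  Finsupp.ofSupportFinite (fun mu => schurCoord mu F)
    ((finite_card_eq n).subset fun _ => card_eq_of_schurCoord_ne_zero hF)

theorem eq_sum_schurCoords {n : ℕ} {F : MvPowerSeries ℕ ℤ} (hF : F ∈ symmFunctions n) :
    F = (schurCoords hF).sum fun mu a => a • schur mu := by
  refine sub_eq_zero.1 (eq_zero_of_schurCoord_eq_zero (n := n) (Submodule.sub_mem _ hF ?_)
    fun mu => ?_)
  · refine Submodule.sum_mem _ fun mu hmu => Submodule.smul_mem _ _ ?_
    rw [← card_eq_of_schurCoord_ne_zero hF (Finsupp.mem_support_iff.1 hmu)]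
    exact schur_mem_symmFunctions mu
  · rw [map_sub, schurCoord_finsuppSum, sub_eq_zero]
    rfl

end Expansion

/-! ### The product `s_ω` in terms of characters -/

section Cycles

theorem sum_ofFn_prod {G R : Type*} [Group G] [Fintype G] [AddCommMonoid R] {d : ℕ} (hd : d ≠ 0)
    (Φ : G → R) : ∑ w : Fin d → G, Φ (List.ofFn w).prod =
      Fintype.card G ^ (d - 1) • ∑ u, Φ u := by
  classical
  obtain ⟨n, rfl⟩ := Nat.exists_eq_succ_of_ne_zero hd
  have htranslate (v : Fin n → G) : ∑ x, Φ (x * (List.ofFn v).prod) = ∑ u, Φ u :=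
    Fintype.sum_equiv (Equiv.mulRight (List.ofFn v).prod) _ _ fun _ => rfl
  rw [← Fintype.sum_equiv (Fin.consEquiv fun _ : Fin (n + 1) => G)
    (fun p => Φ (p.1 * (List.ofFn p.2).prod)) (fun w => Φ (List.ofFn w).prod) fun p => by
      simp [Fin.consEquiv, List.ofFn_succ], Fintype.sum_prod_type_right]
  simp only [htranslate, Finset.sum_const, Finset.card_univ, Fintype.card_fun, Fintype.card_fin,
    Nat.succ_eq_add_one, add_tsub_cancel_right]

theorem partialProd_last {M : Type*} [Monoid M] {n : ℕ} (f : Fin n → M) :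
    Fin.partialProd f (Fin.last n) = (List.ofFn f).prod := by
  rw [Fin.partialProd, List.take_of_length_le (by simp)]

theorem finRotate_castSucc {n : ℕ} (j : Fin n) : finRotate (n + 1) j.castSucc = j.succ :=
  Fin.ext (coe_finRotate_of_ne_last (Fin.castSucc_lt_last j).ne)

variable {d : ℕ} {Y σ : Type*} {w : Fin d → Equiv.Perm Y}

/-- The families `(F_0, …, F_{d-1})` of maps from `Y` such that the map `(j, y) ↦ F_j y` is fixed by
the permutation which sends `(j + 1, y)` to `(j, w_j y)`. -/
abbrev CyclicFamily (w : Fin d → Equiv.Perm Y) (σ : Type*) : Type _ :=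
  {F : Fin d → Y → σ // ∀ j y, F j (w j y) = F (finRotate d j) y}

variable [NeZero d]

theorem CyclicFamily.apply_zero_partialProd (F : CyclicFamily w σ) (j : Fin d) (y : Y) :
    F.1 0 (Fin.partialProd w j.castSucc y) = F.1 j y := by
  obtain ⟨n, rfl⟩ := Nat.exists_eq_succ_of_ne_zero (NeZero.ne d)
  induction j using Fin.induction generalizing y with
  | zero => simp
  | succ j ih =>
    rw [← Fin.succ_castSucc, Fin.partialProd_succ, Equiv.Perm.mul_apply, ih, F.2,
      finRotate_castSucc]

theorem CyclicFamily.apply_zero_ofFn_prod (F : CyclicFamily w σ) (y : Y) :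
    F.1 0 ((List.ofFn w).prod y) = F.1 0 y := by
  obtain ⟨n, rfl⟩ := Nat.exists_eq_succ_of_ne_zero (NeZero.ne d)
  rw [← partialProd_last, ← Fin.succ_last, Fin.partialProd_succ, Equiv.Perm.mul_apply,
    F.apply_zero_partialProd, F.2, finRotate_last]

theorem apply_partialProd_finRotate {f : Y → σ} (hf : ∀ y, f ((List.ofFn w).prod y) = f y)
    (j : Fin d) (y : Y) : f (Fin.partialProd w j.castSucc (w j y)) =
      f (Fin.partialProd w (finRotate d j).castSucc y) := by
  obtain ⟨n, rfl⟩ := Nat.exists_eq_succ_of_ne_zero (NeZero.ne d)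
  rw [← Equiv.Perm.mul_apply, ← Fin.partialProd_succ]
  induction j using Fin.lastCases with
  | last => rw [Fin.succ_last, partialProd_last, hf, finRotate_last, Fin.castSucc_zero,
      Fin.partialProd_zero, Equiv.Perm.one_apply]
  | cast j => rw [finRotate_castSucc, Fin.succ_castSucc]

/-- A cyclic family is determined by its first member, which is any map fixed by the product
`w_0 w_1 ⋯ w_{d-1}`. -/
def cyclicFamilyEquiv (w : Fin d → Equiv.Perm Y) (σ : Type*) :
    CyclicFamily w σ ≃ {f : Y → σ // ∀ y, f ((List.ofFn w).prod y) = f y} where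
  toFun F := ⟨F.1 0, F.apply_zero_ofFn_prod⟩
  invFun f := ⟨fun j y => f.1 (Fin.partialProd w j.castSucc y), apply_partialProd_finRotate f.2⟩
  left_inv F := Subtype.ext (funext fun j => funext fun y => F.apply_zero_partialProd j y)
  right_inv f := Subtype.ext (funext fun y => by simp)

theorem content_cyclicFamilyEquiv [Fintype Y] (F : CyclicFamily w σ) (j : Fin d) :
    content (cyclicFamilyEquiv w σ F).1 = content (F.1 j) := by
  rw [← funext (F.apply_zero_partialProd j)]
  exact (content_comp_equiv (F.1 0) (Fin.partialProd w j.castSucc)).symm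

end Cycles

namespace PType

variable (ω : PType)

instance (i : Fin ω.r) : NeZero (ω.deg i) := ⟨ω.deg_ne i⟩

/-- The permutation of the points by the element `w · circ` of `S ⋊ ∏ S_{d_i}`. -/
def circPerm (w : ω.Base) : Equiv.Perm ω.Point :=
  Equiv.Perm.sigmaCongrRightHom (fun b : ω.Block => Fin (ω.part b.1).card) w *
    ω.topPointHom ω.circ

theorem circPerm_apply (w : ω.Base) (i : Fin ω.r) (k : Fin (ω.deg i))
    (y : Fin (ω.part i).card) : ω.circPerm w ⟨⟨i, k⟩, y⟩ =
      ⟨⟨i, (finRotate (ω.deg i)).symm k⟩, w ⟨i, (finRotate (ω.deg i)).symm k⟩ y⟩ := rfl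

theorem circPerm_finRotate (w : ω.Base) (i : Fin ω.r) (k : Fin (ω.deg i))
    (y : Fin (ω.part i).card) :
    ω.circPerm w ⟨⟨i, finRotate (ω.deg i) k⟩, y⟩ = ⟨⟨i, k⟩, w ⟨i, k⟩ y⟩ := by
  rw [circPerm_apply]
  have hcongr {k'} (h : k' = k) :
      (⟨⟨i, k'⟩, w ⟨i, k'⟩ y⟩ : ω.Point) = ⟨⟨i, k⟩, w ⟨i, k⟩ y⟩ := by
    rw [h]
  exact hcongr (Equiv.symm_apply_apply _ k)

/-- The cycle product of `w` at `i`: the product of its components in the blocks with index `i`. -/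
def cycleProd (w : ω.Base) (i : Fin ω.r) : Equiv.Perm (Fin (ω.part i).card) :=
  (List.ofFn fun k => w ⟨i, k⟩).prod

/-- The maps fixed by `circPerm w`, sorted by the index of the blocks. -/
def fixedCurry (w : ω.Base) : {f : ω.Point → ℕ // ∀ x, f (ω.circPerm w x) = f x} ≃
    ∀ i, CyclicFamily (Y := Fin (ω.part i).card) (fun k => w ⟨i, k⟩) ℕ where
  toFun f i := ⟨fun k y => f.1 ⟨⟨i, k⟩, y⟩, fun j y => by
    have h := f.2 ⟨⟨i, finRotate (ω.deg i) j⟩, y⟩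
    rwa [circPerm_finRotate] at h⟩
  invFun F := ⟨fun x => (F x.1.1).1 x.1.2 x.2, by
    rintro ⟨⟨i, k⟩, y⟩
    obtain ⟨k, rfl⟩ := (finRotate (ω.deg i)).surjective k
    rw [circPerm_finRotate]
    exact (F i).2 k y⟩
  left_inv _ := rfl
  right_inv _ := rfl

theorem fixSeries_circPerm (w : ω.Base) : fixSeries (ω.circPerm w) =
    ∏ i, MvPowerSeries.expand (ω.deg i) (ω.deg_ne i) (fixSeries (ω.cycleProd w i)) := by
  simp only [fixSeries, expand_weightSeries]
  rw [prod_weightSeries ℤ fun i => (finiteFibres_content.comp_injective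
    Subtype.val_injective).injective_comp (smul_right_injective _ (ω.deg_ne i))]
  refine weightSeries_congr ℤ ((ω.fixedCurry w).trans (Equiv.piCongrRight fun i =>
    cyclicFamilyEquiv (Y := Fin (ω.part i).card) (fun k => w ⟨i, k⟩) ℕ)) fun f => ?_
  rw [content, Fintype.sum_sigma, Fintype.sum_sigma]
  refine Finset.sum_congr rfl fun i _ => ?_
  have hcontent (k : Fin (ω.deg i)) := content_cyclicFamilyEquiv (ω.fixedCurry w f i) k
  calc ω.deg i • content (cyclicFamilyEquiv _ ℕ (ω.fixedCurry w f i)).1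
      = ∑ _k : Fin (ω.deg i), content (cyclicFamilyEquiv _ ℕ (ω.fixedCurry w f i)).1 := by
        rw [Finset.sum_const, Finset.card_univ, Fintype.card_fin]
    _ = ∑ k, content ((ω.fixedCurry w f i).1 k) := Finset.sum_congr rfl fun k _ => hcontent k

theorem card_base : Fintype.card ω.Base = ∏ i, (ω.part i).card.factorial ^ ω.deg i := by
  rw [Fintype.card_pi, Fintype.prod_sigma]
  simp [Fintype.card_perm]

theorem card_point : Fintype.card ω.Point = ω.size := by
  rw [Fintype.card_sigma, Fintype.sum_sigma, size]
  simp

theorem sum_base_prod_cycleProd {R : Type*} [CommSemiring R]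
    (Φ : ∀ i, Equiv.Perm (Fin (ω.part i).card) → R) :
    ∑ w : ω.Base, ∏ i, Φ i (ω.cycleProd w i) =
      ∏ i, ((ω.part i).card.factorial ^ (ω.deg i - 1)) • ∑ u, Φ i u := by
  let curry := Equiv.piCurry fun i (_ : Fin (ω.deg i)) => Equiv.Perm (Fin (ω.part i).card)
  rw [Fintype.sum_equiv curry (fun w => ∏ i, Φ i (ω.cycleProd w i))
      (fun w => ∏ i, Φ i (List.ofFn (w i)).prod) fun _ => rfl,
    ← Fintype.piFinset_univ,
    ← Finset.prod_univ_sum (fun _ => Finset.univ) fun i w => Φ i (List.ofFn w).prod]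
  refine Finset.prod_congr rfl fun i _ => ?_
  rw [sum_ofFn_prod (ω.deg_ne i), Fintype.card_perm, Fintype.card_fin]

theorem card_base_smul_schurProd : (Fintype.card ω.Base : ℤ) • ω.schurProd =
    ∑ w : ω.Base, (∏ i, chi (ω.part i) (ω.cycleProd w i)) • fixSeries (ω.circPerm w) := by
  let twistedChar (i : Fin ω.r) (u : Equiv.Perm (Fin (ω.part i).card)) : MvPowerSeries ℕ ℤ :=
    MvPowerSeries.expand (ω.deg i) (ω.deg_ne i) (chi (ω.part i) u • fixSeries u)
  have hsum (i : Fin ω.r) : ∑ u, twistedChar i u = (ω.part i).card.factorial •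
      MvPowerSeries.expand (ω.deg i) (ω.deg_ne i) (schur (ω.part i)) := by
    rw [← map_sum, ← factorial_smul_schur _ (Fintype.card_fin _), natCast_zsmul, map_nsmul]
  have hterm (w : ω.Base) : (∏ i, chi (ω.part i) (ω.cycleProd w i)) • fixSeries (ω.circPerm w) =
      ∏ i, twistedChar i (ω.cycleProd w i) := by
    rw [fixSeries_circPerm, ← Finset.prod_smul]
    exact Finset.prod_congr rfl fun i _ => (map_zsmul _ _ _).symm
  simp only [hterm, sum_base_prod_cycleProd, hsum, smul_smul, pow_sub_one_mul (ω.deg_ne _)]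
  rw [Finset.prod_smul, card_base, natCast_zsmul, schurProd]

theorem schurProd_mem_symmFunctions : ω.schurProd ∈ symmFunctions ω.size := by
  refine mem_symmFunctions_of_zsmul_mem (Nat.cast_ne_zero.2 (Fintype.card_ne_zero (α := ω.Base))) ?_
  rw [card_base_smul_schurProd, ← card_point]
  exact Submodule.sum_mem _ fun w _ => Submodule.smul_mem _ _ (fixSeries_mem_symmFunctions _)

theorem exists_tableaux_of_coeff_schurProd_ne_zero {m : ℕ →₀ ℕ}
    (h : MvPowerSeries.coeff m ω.schurProd ≠ 0) :
    ∃ T : ∀ i, SemistandardYoungTableau (ω.part i), ∑ i, ω.deg i • tableauWeight (T i) = m := by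
  simp only [schurProd, schur_eq_weightSeries, expand_weightSeries] at h
  rw [prod_weightSeries ℤ fun i => (finiteFibres_tableauWeight _).injective_comp
    (smul_right_injective _ (ω.deg_ne i)), coeff_weightSeries] at h
  by_contra! hn
  have : IsEmpty {T : ∀ i, SemistandardYoungTableau (ω.part i) //
    ∑ i, ω.deg i • tableauWeight (T i) = m} := Subtype.isEmpty_of_false hn
  rw [Nat.card_of_isEmpty] at h
  exact h Nat.cast_zero

theorem dominatedBy_of_coeff_schurProd_ne_zero {m : ℕ →₀ ℕ}
    (h : MvPowerSeries.coeff m ω.schurProd ≠ 0) :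
    DominatedBy m fun j => ∑ i, ω.deg i * (ω.part i).rowLen j := fun k => by
  obtain ⟨T, rfl⟩ := ω.exists_tableaux_of_coeff_schurProd_ne_zero h
  simp only [Finsupp.finsetSum_apply, Finsupp.smul_apply, smul_eq_mul]
  rw [Finset.sum_comm, Finset.sum_comm (s := Finset.range k)]
  refine Finset.sum_le_sum fun i _ => ?_
  rw [← Finset.mul_sum, ← Finset.mul_sum]
  exact Nat.mul_le_mul_left _ (tableauWeight_dominatedBy_rowLen (T i) k)

/-- The twisted Littlewood–Richardson coefficients, as the coordinates of `s_ω` in the Schur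
functions. -/
def twistedLR : YoungDiagram →₀ ℤ := schurCoords ω.schurProd_mem_symmFunctions

theorem isTwistedLR_twistedLR : ω.IsTwistedLR ω.twistedLR := by
  refine ⟨fun mu hmu => ?_, eq_sum_schurCoords ω.schurProd_mem_symmFunctions⟩
  obtain ⟨m, hcoeff, -, hdom⟩ := exists_dominating_of_schurCoord_ne_zero hmu
  exact ⟨card_eq_of_schurCoord_ne_zero ω.schurProd_mem_symmFunctions hmu,
    hdom.trans (ω.dominatedBy_of_coeff_schurProd_ne_zero hcoeff)⟩

variable {ω} in
theorem IsTwistedLR.eq_twistedLR {c : YoungDiagram →₀ ℤ} (h : ω.IsTwistedLR c) :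
    c = ω.twistedLR := by
  ext mu
  rw [← schurCoord_finsuppSum c mu, ← h.2]
  rfl

theorem card_base_mul_twistedLR (mu : YoungDiagram) :
    (Fintype.card ω.Base : ℤ) * ω.twistedLR mu =
      ∑ w : ω.Base, (∏ i, chi (ω.part i) (ω.cycleProd w i)) * chi mu (ω.circPerm w) := by
  change _ * schurCoord mu ω.schurProd = _
  rw [← smul_eq_mul, ← map_zsmul, card_base_smul_schurProd, map_sum]
  exact Finset.sum_congr rfl fun w _ => by rw [map_zsmul, smul_eq_mul, ← chi_eq_schurCoord]

end PType

/-! ### Traces on `V_ω` -/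

section ClosedWalks

variable {I R : Type*} [Fintype I] [DecidableEq I] [CommSemiring R]

theorem ofFn_prod_apply {n : ℕ} (M : Fin (n + 1) → Matrix I I R) (a b : I) :
    (List.ofFn M).prod a b = ∑ f : Fin n → I,
      ∏ j, M j ((Fin.cons a f : Fin (n + 1) → I) j) ((Fin.snoc f b : Fin (n + 1) → I) j) := by
  induction n generalizing a with
  | zero => simp [Fin.snoc]
  | succ n ih =>
    rw [List.ofFn_succ, List.prod_cons, Matrix.mul_apply,
      ← Fintype.sum_equiv (Fin.consEquiv fun _ : Fin (n + 1) => I)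
        (fun p => ∏ j, M j ((Fin.cons a (Fin.cons p.1 p.2 : Fin (n + 1) → I) : Fin (n + 2) → I) j)
          ((Fin.snoc (Fin.cons p.1 p.2 : Fin (n + 1) → I) b : Fin (n + 2) → I) j)) _ fun _ => rfl,
      Fintype.sum_prod_type]
    refine Finset.sum_congr rfl fun c _ => ?_
    rw [ih, Finset.mul_sum]
    refine Finset.sum_congr rfl fun f _ => ?_
    rw [Fin.prod_univ_succ (n := n + 1), ← Fin.cons_snoc_eq_snoc_cons]
    simp only [Fin.cons_zero, Fin.cons_succ]

/-- The summands are the closed walks `f_0, f_1, …, f_{d-1}, f_0`. -/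
theorem trace_ofFn_prod {d : ℕ} (hd : d ≠ 0) (M : Fin d → Matrix I I R) :
    (List.ofFn M).prod.trace = ∑ f : Fin d → I, ∏ j, M j (f j) (f (finRotate d j)) := by
  obtain ⟨n, rfl⟩ := Nat.exists_eq_succ_of_ne_zero hd
  rw [← Fintype.sum_equiv (Fin.consEquiv fun _ : Fin (n + 1) => I)
    (fun p => ∏ j, M j ((Fin.cons p.1 p.2 : Fin (n + 1) → I) j)
      ((Fin.cons p.1 p.2 : Fin (n + 1) → I) (finRotate (n + 1) j))) _ fun _ => rfl,
    Fintype.sum_prod_type, Matrix.trace]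
  refine Finset.sum_congr rfl fun a _ => ?_
  rw [Matrix.diag_apply, ofFn_prod_apply]
  simp only [Fin.snoc_eq_cons_rotate]

end ClosedWalks

section DualMatrix

variable {κ G E I : Type*} [Field κ] [Group G] [AddCommGroup E] [Module κ E] [Fintype I]
  [DecidableEq I] (ρ : Representation κ G E) (b : Module.Basis I κ E)

/-- The matrices `ρ(g⁻¹)ᵀ` of the contragredient representation, in the dual basis. -/
def dualMatrix : G →* Matrix I I κ where
  toFun g := (LinearMap.toMatrix b b (ρ g⁻¹)).transpose
  map_one' := by
    rw [inv_one, map_one, LinearMap.toMatrix_one, Matrix.transpose_one]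
  map_mul' g h := by
    rw [mul_inv_rev, map_mul, LinearMap.toMatrix_mul, Matrix.transpose_mul]

theorem dualMatrix_apply (g : G) (x y : I) : dualMatrix ρ b g x y = b.repr (ρ g⁻¹ (b x)) y :=
  LinearMap.toMatrix_apply _ _ _ _ _

theorem trace_dualMatrix (g : G) : (dualMatrix ρ b g).trace = ρ.character g⁻¹ := by
  rw [Representation.character, LinearMap.trace_eq_matrix_trace κ b, ← Matrix.trace_transpose]
  rfl

theorem character_ofFn_prod_inv {d : ℕ} (hd : d ≠ 0) (g : Fin d → G) :
    ρ.character (List.ofFn g).prod⁻¹ =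
      ∑ f : Fin d → I, ∏ j, dualMatrix ρ b (g j) (f j) (f (finRotate d j)) := by
  rw [← trace_dualMatrix ρ b, map_list_prod, List.map_ofFn, trace_ofFn_prod hd]
  rfl

end DualMatrix

namespace PType

variable (ω : PType) {κ : Type*} [Field κ] {V : YoungDiagram → Type*}
  [∀ lam, AddCommGroup (V lam)] [∀ lam, Module κ (V lam)]
  (ρ : ∀ lam : YoungDiagram, Representation κ (Equiv.Perm (Fin lam.card)) (V lam))

theorem extRep_inl (w : ω.Base) : ω.extRep ρ (SemidirectProduct.inl w) = ω.baseRep ρ w := by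
  change ω.baseRep ρ _ * ω.topRep κ V 1 = _
  rw [map_one, mul_one]
  rfl

theorem extRep_inr (p : ω.Top) : ω.extRep ρ (SemidirectProduct.inr p) = ω.topRep κ V p := by
  change ω.baseRep ρ 1 * ω.topRep κ V _ = _
  rw [map_one, one_mul]
  rfl

theorem extRep_inv_tprod (w : ω.Base) (x : ∀ b : ω.Block, V (ω.part b.1)) :
    ω.extRep ρ (SemidirectProduct.inl w * SemidirectProduct.inr ω.circ)⁻¹
        (PiTensorProduct.tprod κ x) =
      PiTensorProduct.tprod κ fun b : ω.Block => ρ (ω.part b.1)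
        (w ⟨b.1, ω.circ b.1 b.2⟩)⁻¹ (x ⟨b.1, ω.circ b.1 b.2⟩) := by
  rw [mul_inv_rev, ← map_inv, ← map_inv, map_mul, extRep_inl, extRep_inr, Module.End.mul_apply,
    baseRep_tprod]
  exact ω.topOp_tprod _ _

theorem toMatrix_extRep_inv_apply_self {I : Fin ω.r → Type*} [∀ i, Fintype (I i)]
    [∀ i, DecidableEq (I i)] (b : ∀ i, Module.Basis (I i) κ (V (ω.part i))) (w : ω.Base)
    (f : ∀ c : ω.Block, I c.1) :
    LinearMap.toMatrix (Basis.piTensorProduct fun c : ω.Block => b c.1)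
        (Basis.piTensorProduct fun c : ω.Block => b c.1)
        (ω.extRep ρ (SemidirectProduct.inl w * SemidirectProduct.inr ω.circ)⁻¹) f f =
      ∏ i, ∏ k, dualMatrix (ρ (ω.part i)) (b i) (w ⟨i, k⟩) (f ⟨i, k⟩)
        (f ⟨i, finRotate (ω.deg i) k⟩) := by
  rw [LinearMap.toMatrix_apply, Basis.piTensorProduct_apply, extRep_inv_tprod,
    Basis.piTensorProduct_repr_tprod_apply, Fintype.prod_sigma]
  refine Finset.prod_congr rfl fun i _ => ?_
  refine (Fintype.prod_equiv (finRotate (ω.deg i)) _ _ fun k => ?_).symm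
  have hcongr {k'} (h : k' = k) : dualMatrix (ρ (ω.part i)) (b i) (w ⟨i, k⟩) (f ⟨i, k⟩)
      (f ⟨i, finRotate (ω.deg i) k⟩) = (b i).repr (ρ (ω.part i) (w ⟨i, k'⟩)⁻¹
        (b i (f ⟨i, k'⟩))) (f ⟨i, finRotate (ω.deg i) k⟩) := by
    rw [h, dualMatrix_apply]
  exact hcongr (Equiv.symm_apply_apply _ k)

theorem character_extRep_inv [∀ lam, FiniteDimensional κ (V lam)] (w : ω.Base) :
    (ω.extRep ρ).character (SemidirectProduct.inl w * SemidirectProduct.inr ω.circ)⁻¹ =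
      ∏ i, (ρ (ω.part i)).character (ω.cycleProd w i)⁻¹ := by
  classical
  let b (i : Fin ω.r) := Module.finBasis κ (V (ω.part i))
  simp only [cycleProd, character_ofFn_prod_inv _ (b _) (ω.deg_ne _)]
  rw [Representation.character,
    LinearMap.trace_eq_matrix_trace κ (Basis.piTensorProduct fun c : ω.Block => b c.1),
    Matrix.trace, Finset.prod_univ_sum, Fintype.piFinset_univ]
  exact Fintype.sum_equiv (Equiv.piCurry fun i (_ : Fin (ω.deg i)) =>
    Fin (Module.finrank κ (V (ω.part i)))) _ _ fun f =>
      ω.toMatrix_extRep_inv_apply_self ρ b w f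

end PType

/-! ### Frobenius reciprocity -/

section Projection

variable {κ E U : Type*} [Field κ] [AddCommGroup E] [Module κ E]

theorem trace_eq_trace_mul_of_isProj [FiniteDimensional κ E] [AddCommGroup U] [Module κ U]
    {j : U →ₗ[κ] E} (hj : Function.Injective j)
    {P : Module.End κ E} (hP : LinearMap.IsProj (LinearMap.range j) P)
    {T : Module.End κ U} {A : Module.End κ E} (hT : ∀ u, j (T u) = A (j u)) :
    LinearMap.trace κ U T = LinearMap.trace κ E (A * P) := by
  have : FiniteDimensional κ U := FiniteDimensional.of_injective j hj
  let π : E →ₗ[κ] U := (LinearEquiv.ofInjective j hj).symm.toLinearMap ∘ₗ hP.codRestrict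
  have hjπ (x : E) : j (π x) = P x :=
    congrArg Subtype.val (LinearEquiv.apply_symm_apply (LinearEquiv.ofInjective j hj) _)
  have hπj (u : U) : π (j u) = u := hj ((hjπ _).trans (hP.map_id _ ⟨u, rfl⟩))
  have hfactor : T = (T ∘ₗ π) ∘ₗ j :=
    LinearMap.ext fun u => (congrArg T (hπj u)).symm
  have hswap : j ∘ₗ (T ∘ₗ π) = A * P :=
    LinearMap.ext fun x => (hT (π x)).trans (congrArg A (hjπ x))
  rw [hfactor, LinearMap.trace_comp_comm', hswap]

theorem trace_mul_averageMap {G : Type*} [Group G] [Fintype G] [Invertible (Fintype.card G : κ)]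
    (R : Representation κ G E) (A : Module.End κ E) :
    LinearMap.trace κ E (A * R.averageMap) =
      ⅟(Fintype.card G : κ) * ∑ g, LinearMap.trace κ E (A * R g) := by
  have haverage : R.averageMap = ⅟(Fintype.card G : κ) • ∑ g, R g := by
    simp [GroupAlgebra.average]
  rw [haverage, mul_smul_comm, Finset.mul_sum, map_smul, map_sum, smul_eq_mul]

end Projection

section Induced

variable {k G H A B : Type*} [CommRing k] [Group G] [Group H] [AddCommGroup A] [Module k A]
  [AddCommGroup B] [Module k B] (φ : G →* H) (ρ : Representation k G A) (τ : Representation k H B)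

theorem invariants_comp_of_surjective {φ : G →* H} (hφ : Function.Surjective φ) :
    Representation.invariants (τ.comp φ) = τ.invariants := by
  ext x
  exact (hφ.forall (p := fun h => τ h x = x)).symm

/-- The restriction of `H`-homomorphisms on the induced representation to its subspace `1 ⊗ A`. -/
def restrictInd : Representation.IntertwiningMap (ρ.ind φ) τ →ₗ[k] A →ₗ[k] B where
  toFun f := f.toLinearMap ∘ₗ Representation.IndV.mk φ ρ 1
  map_add' _ _ := rfl
  map_smul' _ _ := rfl

theorem indHom_apply_mk (f : Representation.IntertwiningMap (ρ.ind φ) τ) (h : H) (a : A) :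
    f (Representation.IndV.mk φ ρ h a) = τ h⁻¹ (restrictInd φ ρ τ f a) := by
  change _ = τ h⁻¹ (f (Representation.IndV.mk φ ρ 1 a))
  rw [← f.isIntertwining, Representation.ind_mk, inv_inv, one_mul]

theorem restrictInd_injective : Function.Injective (restrictInd φ ρ τ) := by
  intro f f' hff'
  refine Representation.IntertwiningMap.ext (Representation.IndV.hom_ext _ _ fun h =>
    LinearMap.ext fun a => ?_)
  exact (indHom_apply_mk φ ρ τ f h a).trans (by rw [hff', ← indHom_apply_mk]; rfl)

variable {ρ τ} in
/-- The `H`-homomorphism `h ⊗ a ↦ h⁻¹ · f(a)` on the coinvariants `(k[H] ⊗ A)_G` which extends the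
`G`-homomorphism `f`. -/
def liftInd (f : Representation.IntertwiningMap ρ (τ.comp φ)) :
    Representation.IntertwiningMap (ρ.ind φ) τ where
  toLinearMap := Representation.Coinvariants.lift _
    (TensorProduct.lift ((Finsupp.lift _ _ _ fun h => τ h⁻¹ ∘ₗ f.toLinearMap) ∘ₗ
      (MonoidAlgebra.coeffLinearEquiv k).toLinearMap)) fun g => by
        ext h a
        simp [f.isIntertwining]
  isIntertwining' g := by ext; simp

theorem range_restrictInd : LinearMap.range (restrictInd φ ρ τ) =
    Representation.invariants (ρ.linHom (τ.comp φ)) := by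
  ext f
  refine Iff.trans ?_ (Representation.mem_linHom_invariants_iff_isIntertwining f).symm
  constructor
  · rintro ⟨f, rfl⟩
    refine ⟨fun g a => ?_⟩
    have hmk : Representation.IndV.mk φ ρ 1 (ρ g a) = Representation.IndV.mk φ ρ (φ g)⁻¹ a := by
      simpa using (Representation.Coinvariants.mk_inv_tmul
        (ρ := (Representation.leftRegular k H).comp φ) (τ := ρ) (.single 1 1) a g).symm
    change f (Representation.IndV.mk φ ρ 1 (ρ g a)) = _
    rw [hmk, indHom_apply_mk, inv_inv, MonoidHom.comp_apply]
  · intro hf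
    refine ⟨liftInd φ ⟨f, fun g => LinearMap.ext (hf.isIntertwining g)⟩, ?_⟩
    ext a
    simp [restrictInd, liftInd]

end Induced

namespace PType

variable (ω : PType) {κ : Type*} [Field κ] {V : YoungDiagram → Type*}
  [∀ lam, AddCommGroup (V lam)] [∀ lam, Module κ (V lam)]
  (ρ : ∀ lam : YoungDiagram, Representation κ (Equiv.Perm (Fin lam.card)) (V lam))
  {n : ℕ} (e : ω.Point ≃ Fin n) {M : Type*} [AddCommGroup M] [Module κ M]
  (τ : Representation κ (Equiv.Perm (Fin n)) M)

/-- The action of `S ⋊ ∏ S_{d_i}` on `Hom(V_ω, M)` which corresponds under `restrictInd` to its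
action on `Hom_{S_n}(Ind_S^{S_n}(V_ω), M)`. -/
abbrev linHomRep : Representation κ ω.Ext (ω.VSpace κ V →ₗ[κ] M) :=
  (ω.extRep ρ).linHom (τ.comp (ω.extHom e))

theorem restrictInd_homRep (t : ω.Ext) (f : Representation.IntertwiningMap (ω.indRep ρ e) τ) :
    restrictInd _ _ τ (ω.homRep ρ e τ t f) = ω.linHomRep ρ e τ t (restrictInd _ _ τ f) := by
  refine LinearMap.ext fun u => ?_
  change f (ω.extInd ρ e t⁻¹ (Representation.IndV.mk _ _ 1 u)) =
    τ (ω.extHom e t) (restrictInd _ _ τ f (ω.extRep ρ t⁻¹ u))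
  rw [extInd_mk, mul_one, indHom_apply_mk, map_inv (ω.extHom e), inv_inv]

theorem extHom_inl (w : ω.Base) : ω.extHom e (SemidirectProduct.inl w) = ω.baseHom e w :=
  SemidirectProduct.lift_inl _ _ _ w

theorem repS_baseEquiv (w : ω.Base) : ω.repS ρ e (ω.baseEquiv e w) = ω.baseRep ρ w :=
  congrArg (ω.baseRep ρ) ((ω.baseEquiv e).symm_apply_apply w)

theorem linHomRep_comp_inl : (ω.linHomRep ρ e τ).comp SemidirectProduct.inl =
    ((ω.repS ρ e).linHom (τ.comp (ω.subgroupS e).subtype)).comp (ω.baseEquiv e).toMonoidHom := by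
  refine MonoidHom.ext fun w => LinearMap.ext fun φ => LinearMap.ext fun u => ?_
  change τ (ω.extHom e (SemidirectProduct.inl w)) (φ (ω.extRep ρ (SemidirectProduct.inl w)⁻¹ u)) =
    τ (ω.baseHom e w) (φ (ω.repS ρ e (ω.baseEquiv e w)⁻¹ u))
  rw [extHom_inl, ← map_inv, ← map_inv, extRep_inl, repS_baseEquiv]

theorem range_restrictInd_eq_invariants_linHomRep :
    LinearMap.range (restrictInd (ω.subgroupS e).subtype (ω.repS ρ e) τ) =
      Representation.invariants ((ω.linHomRep ρ e τ).comp SemidirectProduct.inl) := by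
  rw [range_restrictInd, linHomRep_comp_inl]
  exact (invariants_comp_of_surjective _ (ω.baseEquiv e).surjective).symm

theorem trace_homRep [CharZero κ] [∀ lam, FiniteDimensional κ (V lam)] [FiniteDimensional κ M]
    (t : ω.Ext) : (Fintype.card ω.Base : κ) * (ω.homRep ρ e τ).character t =
      ∑ w : ω.Base, (ω.extRep ρ).character (t * SemidirectProduct.inl w)⁻¹ *
        τ.character (ω.extHom e (t * SemidirectProduct.inl w)) := by
  have : FiniteDimensional κ (ω.VSpace κ V) :=
    Module.Finite.of_basis (Basis.piTensorProduct fun b => Module.finBasis κ (V (ω.part b.1)))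
  have := invertibleOfNonzero (Nat.cast_ne_zero (R := κ).2 (Fintype.card_ne_zero (α := ω.Base)))
  have hproj := Representation.isProj_averageMap ((ω.linHomRep ρ e τ).comp SemidirectProduct.inl)
  rw [← range_restrictInd_eq_invariants_linHomRep] at hproj
  rw [Representation.character, trace_eq_trace_mul_of_isProj (restrictInd_injective _ _ τ) hproj
    (ω.restrictInd_homRep ρ e τ t), trace_mul_averageMap, mul_invOf_cancel_left]
  refine Finset.sum_congr rfl fun w _ => ?_
  rw [MonoidHom.comp_apply, ← map_mul]
  exact Representation.char_linHom _ _ _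

end PType

/-! ### The element `v` -/

namespace PType

variable (ω : PType) {n : ℕ} (e : ω.Point ≃ Fin n)

theorem extHom_eq_permCongr (g : ω.Ext) : ω.extHom e g =
    e.permCongr (Equiv.Perm.sigmaCongrRightHom (fun b : ω.Block => Fin (ω.part b.1).card) g.left *
      ω.topPointHom g.right) :=
  (map_mul e.permCongrHom _ _).symm

theorem extHom_inl_mul_inr_circ (w : ω.Base) :
    ω.extHom e (SemidirectProduct.inl w * SemidirectProduct.inr ω.circ) =
      e.permCongr (ω.circPerm w) := by
  rw [extHom_eq_permCongr, SemidirectProduct.mul_left, SemidirectProduct.mul_right]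
  simp [circPerm]

theorem card_part_pos (i : Fin ω.r) : 0 < (ω.part i).card := by
  refine Nat.pos_of_ne_zero fun h => ω.part_ne i (YoungDiagram.ext ?_)
  rw [YoungDiagram.cells_bot]
  exact Finset.card_eq_zero.1 h

theorem extHom_injective : Function.Injective (ω.extHom e) := by
  rw [injective_iff_map_eq_one]
  intro g hg
  rw [extHom_eq_permCongr] at hg
  have hpoints := e.permCongrHom.injective (hg.trans (map_one e.permCongrHom).symm)
  have hright : g.right = 1 := by
    refine funext fun i => Equiv.ext fun k => ?_
    have hblock := congrArg Sigma.fst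
      (DFunLike.congr_fun hpoints ⟨⟨i, k⟩, ⟨0, ω.card_part_pos i⟩⟩)
    exact eq_of_heq (Sigma.mk.inj hblock).2
  rw [hright, map_one, mul_one] at hpoints
  refine SemidirectProduct.ext (Equiv.Perm.sigmaCongrRightHom_injective ?_) hright
  rw [hpoints, SemidirectProduct.one_left, map_one]

variable {κ : Type*} [Field κ] {V : YoungDiagram → Type*} [∀ lam, AddCommGroup (V lam)]
  [∀ lam, Module κ (V lam)]
  {ρ : ∀ lam : YoungDiagram, Representation κ (Equiv.Perm (Fin lam.card)) (V lam)} {t : ω.Ext}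

theorem exists_eq_of_mk_eq_v
    (ht : (QuotientGroup.mk (ω.extToN ρ e t) : stabW (ω.subgroupS e) (ω.repS ρ e)) = ω.v ρ e) :
    ∃ w : ω.Base, t = SemidirectProduct.inr ω.circ * SemidirectProduct.inl w := by
  have hmem := QuotientGroup.eq.1 ht.symm
  rw [← map_inv, ← map_mul, Subgroup.mem_subgroupOf, Subgroup.mem_subgroupOf] at hmem
  obtain ⟨w, hw⟩ := hmem
  refine ⟨w, inv_mul_eq_iff_eq_mul.1 (ω.extHom_injective e ?_)⟩
  rw [extHom_inl, hw]
  rfl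

theorem card_base_mul_character_homRep [CharZero κ] [∀ lam, FiniteDimensional κ (V lam)]
    {M : Type*} [AddCommGroup M] [Module κ M] [FiniteDimensional κ M]
    (τ : Representation κ (Equiv.Perm (Fin n)) M)
    (ht : (QuotientGroup.mk (ω.extToN ρ e t) : stabW (ω.subgroupS e) (ω.repS ρ e)) = ω.v ρ e) :
    (Fintype.card ω.Base : κ) * (ω.homRep ρ e τ).character t = ∑ w : ω.Base,
      (∏ i, (ρ (ω.part i)).character (ω.cycleProd w i)⁻¹) *
        τ.character (e.permCongr (ω.circPerm w)) := by
  obtain ⟨w₀, rfl⟩ := ω.exists_eq_of_mk_eq_v e ht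
  rw [trace_homRep]
  refine Fintype.sum_equiv ((Equiv.mulLeft w₀).trans (ω.topAut ω.circ).toEquiv) _ _ fun w => ?_
  have hcoset : (SemidirectProduct.inr ω.circ * SemidirectProduct.inl w₀ *
      SemidirectProduct.inl w : ω.Ext) =
        SemidirectProduct.inl (ω.topAut ω.circ (w₀ * w)) * SemidirectProduct.inr ω.circ := by
    rw [mul_assoc, ← map_mul]
    ext1 <;> simp
  rw [hcoset, extHom_inl_mul_inr_circ, character_extRep_inv]
  rfl

end PType

end TwistedLR

end

theorem mainTheorem12 {κ : Type*} [Field κ] [CharZero κ]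
    (V : YoungDiagram → Type*) [∀ lam, AddCommGroup (V lam)] [∀ lam, Module κ (V lam)]
    [∀ lam, FiniteDimensional κ (V lam)]
    (ρ : ∀ lam : YoungDiagram, Representation κ (Equiv.Perm (Fin lam.card)) (V lam))
    (hirr : ∀ lam, (ρ lam).IsIrreducible)
    (hchar : ∀ lam g, (ρ lam).character g = (TwistedLR.chi lam g : κ))
    (ω : TwistedLR.PType) :
    ∃ c : YoungDiagram →₀ ℤ,
      (ω.IsTwistedLR c ∧ ∀ c' : YoungDiagram →₀ ℤ, ω.IsTwistedLR c' → c' = c) ∧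
      ∀ (mu : YoungDiagram) (e : ω.Point ≃ Fin mu.card) (t : ω.Ext),
        (QuotientGroup.mk (ω.extToN ρ e t) :
            TwistedLR.stabW (ω.subgroupS e) (ω.repS ρ e)) = ω.v ρ e →
          LinearMap.trace κ
              (Representation.IntertwiningMap (ω.indRep ρ e) (ρ mu))
              (ω.homRep ρ e (ρ mu) t) = (c mu : κ) := by
  refine ⟨ω.twistedLR, ⟨ω.isTwistedLR_twistedLR, fun c' h => h.eq_twistedLR⟩, fun mu e t ht => ?_⟩
  have hcard : (Fintype.card ω.Base : κ) ≠ 0 := Nat.cast_ne_zero.2 Fintype.card_ne_zero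
  have htrace := ω.card_base_mul_character_homRep e (ρ mu) ht
  simp only [hchar, TwistedLR.chi_inv, TwistedLR.chi_permCongr] at htrace
  have hcoeff := congrArg (Int.cast : ℤ → κ) (ω.card_base_mul_twistedLR mu)
  push_cast at hcoeff
  exact mul_left_cancel₀ hcard (htrace.trans hcoeff.symm)
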